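/- Let $D\subset\mathbb{C}$ be the open unit disc, $\mathcal{A}=\{(\alpha,\beta)\in D\times D : \alpha\neq\beta\}$, and $$S(\alpha,\beta)=\frac{|1-\alpha|\,|1-\beta|}{|1+\alpha|\,|1+\beta|}.$$ The universal cover of $\mathcal{A}$ is $$\tilde{\mathcal{A}}=\{(p,k,\tilde u,\tilde v)\in\mathbb{R}^+\times(0,1)\times\mathbb{R}\times\mathbb{R} : \tilde u<\tilde v<\tilde u+2\pi\},$$ with projection $\tilde\pi(p,k,\tilde u,\tilde v)=(\alpha,\beta)=(f^{-1}(1),f^{-1}(k^{-1}))$, where, with $u=\tan\frac{\tilde u}{2}$, $v=\tan\frac{\tilde v}{2}$, $w(ix)=\sqrt{(1+x^2)(1+k^2x^2)}$, $$z_0=\frac{\sqrt{p\,w(iu)w(iv)}}{p\,w(iv)+w(iu)}|u-v|+i\,\frac{p\,u\,w(iv)+v\,w(iu)}{p\,w(iv)+w(iu)},\qquad f^{-1}(z)=\frac{iu+\bar z_0}{iu-z_0}\cdot\frac{z-z_0}{z+\bar z_0}$$ (extended continuously to $u=\infty$ and to $v=\infty$). Let $K=K(k)$ and $E=E(k)$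 be the complete elliptic integrals of the first and second kind of modulus $k$, let $$\tilde F(x;k)=\frac12\int_0^{x}\frac{ds}{\sqrt{\cos^2\frac s2+k^2\sin^2\frac s2}},\qquad \tilde E(x;k)=\frac{1-k^2}{2}\int_0^{x}\frac{ds}{\sqrt{\cos^2\frac s2+k^2\sin^2\frac s2}+k},$$ and define $\tilde T:\tilde{\mathcal{A}}\to\mathbb{R}$ by $$2\pi\tilde T(p,k,\tilde u,\tilde v)=4p\left[E\tilde F(\tilde v;k)-K\tilde E(\tilde v;k)\right]-4\left[E\tilde F(\tilde u;k)-K\tilde E(\tilde u;k)\right]-4K\left[p\left(\frac{w(iv)}{u-v}+kv\right)+\left(\frac{w(iu)}{u-v}-ku\right)\right],$$ where the last bracket is extended continuously to $u=\infty$ and to $v=\infty$. For $p>0$ and $q\in\mathbb{R}$ let $\tilde{\mathcal{A}}(p)$ be the subset of $\tilde{\mathcal{A}}$ where $S\circ\tilde\pi=p$, and $\tilde{\mathcal{A}}(p,q)$ the subset of $\tilde{\mathcal{A}}(p)$ where $\tilde T=q$. Let $p>0$. (a) If $p\le 1$, then $(p,k,\tilde u,\tilde v)\mapsto(\tilde T(p,k,\tilde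 u,\tilde v),k,\tilde u)$ is a diffeomorphism from $\tilde{\mathcal{A}}(p)$ onto $\{(q,k,\tilde u)\in\mathbb{R}\times(0,1)\times\mathbb{R}\}$, so that fixing the value $q$ gives the level set $\tilde{\mathcal{A}}(p,q)$. For every $q\in\mathbb{R}$ this level set is a graph over $(0,1)\times\mathbb{R}$: there is a smooth $h:(0,1)\times\mathbb{R}\to\mathbb{R}$ with $\tilde{\mathcal{A}}(p,q)=\{(p,k,\tilde u,h(k,\tilde u)) : k\in(0,1),\ \tilde u\in\mathbb{R}\}$. (b) If $p\ge 1$, then $(p,k,\tilde u,\tilde v)\mapsto(\tilde T(p,k,\tilde u,\tilde v),k,\tilde v)$ is a diffeomorphism from $\tilde{\mathcal{A}}(p)$ onto $\{(q,k,\tilde v)\in\mathbb{R}\times(0,1)\times\mathbb{R}\}$, so that fixing the value $q$ gives the level set $\tilde{\mathcal{A}}(p,q)$. For every $q\in\mathbb{R}$ there is a smooth $h:(0,1)\times\mathbb{R}\to\mathbb{R}$ with $\tilde{\mathcal{A}}(p,q)=\{(p,k,h(k,\tilde v),\tilde v) : k\in(0,1),\ \tilde v\in\mathbb{R}\}$.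 -/

import Mathlib

open scoped ContDiff

namespace GenusOne

noncomputable section

/-! ### The parameter space of genus one curves -/

/-- `𝒜 = (D × D) ∖ Δ`: pairs `(α, β)` of distinct points of the open unit disc, i.e. the labelled
branch points in the disc of the curve `η² = (ζ-α)(1-ᾱζ)(ζ-β)(1-β̄ζ)`. -/
def curveSpace : Set (ℂ × ℂ) := {y | ‖y.1‖ < 1 ∧ ‖y.2‖ < 1 ∧ y.1 ≠ y.2}

/-- `S(α, β) = |1-α| |1-β| / (|1+α| |1+β|)`. -/
def S (y : ℂ × ℂ) : ℝ := ‖1 - y.1‖ * ‖1 - y.2‖ / (‖1 + y.1‖ * ‖1 + y.2‖)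

/-! ### Elliptic integrals -/

/-- The complete elliptic integral of the first kind `K(k)`, as a function of the modulus. -/
def ellipticK (k : ℝ) : ℝ :=
  ∫ θ in (0 : ℝ)..(Real.pi / 2), 1 / √(1 - k ^ 2 * Real.sin θ ^ 2)

/-- The complete elliptic integral of the second kind `E(k)`, as a function of the modulus. -/
def ellipticE (k : ℝ) : ℝ :=
  ∫ θ in (0 : ℝ)..(Real.pi / 2), √(1 - k ^ 2 * Real.sin θ ^ 2)

/-- `√(cos²(s/2) + k² sin²(s/2))`.  With `x = tan (s/2)` and
`w(i x) = √((1 + x²)(1 + k² x²))` it equals `cos²(s/2) · w(i x)`. -/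
def delta (k s : ℝ) : ℝ := √(Real.cos (s / 2) ^ 2 + k ^ 2 * Real.sin (s / 2) ^ 2)

/-- `F̃(s; k)`, the continuation to all real `s` of `Im F(i tan (s/2); k)`. -/
def Ftilde (s k : ℝ) : ℝ := 1 / 2 * ∫ t in (0 : ℝ)..s, 1 / delta k t

/-- `Ẽ(s; k)`, the continuation to all real `s` of `Im (E(i x; k) - k i x)`, `x = tan (s/2)`. -/
def Etilde (s k : ℝ) : ℝ :=
  1 / 2 * (1 - k ^ 2) * ∫ t in (0 : ℝ)..s, 1 / (delta k t + k)

/-! ### The universal cover and the function `T̃`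

Points of `ℝ × ℝ × ℝ × ℝ` are written `(p, k, ũ, ṽ)`.  -/

/-- The universal cover `𝒜̃` of `𝒜`, in the coordinates `(p, k, ũ, ṽ)`.  That it is the universal
cover, with the projection `proj` below, is
`simplyConnectedSpace_cover`, `isCoveringMap_proj` and `surjOn_proj` below. -/
def cover : Set (ℝ × ℝ × ℝ × ℝ) :=
  {x | 0 < x.1 ∧ x.2.1 ∈ Set.Ioo (0 : ℝ) 1 ∧
    x.2.2.1 < x.2.2.2 ∧ x.2.2.2 < x.2.2.1 + 2 * Real.pi}

/-- `z₀ = f(0)`, where `f` is the Möbius transformation taking `α, 1/ᾱ, β, 1/β̄` to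
`1, -1, 1/k, -1/k`, and `f(1) = i u`, `f(-1) = i v` with `u = tan (ũ/2)`, `v = tan (ṽ/2)`.
This is
`z₀ = √(p w(iu) w(iv)) |u-v| / (p w(iv) + w(iu)) + i (p u w(iv) + v w(iu)) / (p w(iv) + w(iu))`
with numerators and denominators multiplied by `cos²(ũ/2) cos²(ṽ/2)`, so that `u = ∞` and `v = ∞`
are allowed; see `zZero_eq`. -/
def zZero (x : ℝ × ℝ × ℝ × ℝ) : ℂ :=
  match x with
  | (p, k, u, v) =>
    (⟨√(p * delta k u * delta k v) * |Real.sin (u / 2 - v / 2)|,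
      p * delta k v * (Real.sin (u / 2) * Real.cos (u / 2))
        + delta k u * (Real.sin (v / 2) * Real.cos (v / 2))⟩ : ℂ) /
    ((p * delta k v * Real.cos (u / 2) ^ 2 + delta k u * Real.cos (v / 2) ^ 2 : ℝ) : ℂ)

/-- `f⁻¹(z) = (i u + z̄₀)/(i u - z₀) · (z - z₀)/(z + z̄₀)` with `u = tan (ũ/2)`; the first fraction
is multiplied by `cos (ũ/2)` above and below. -/
def fInv (x : ℝ × ℝ × ℝ × ℝ) (z : ℂ) : ℂ :=
  (Complex.I * Real.sin (x.2.2.1 / 2) + starRingEnd ℂ (zZero x) * Real.cos (x.2.2.1 / 2)) /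
    (Complex.I * Real.sin (x.2.2.1 / 2) - zZero x * Real.cos (x.2.2.1 / 2)) *
  ((z - zZero x) / (z + starRingEnd ℂ (zZero x)))

/-- The covering projection `π̃ : 𝒜̃ → 𝒜`, `(p, k, ũ, ṽ) ↦ (α, β) = (f⁻¹(1), f⁻¹(1/k))`. -/
def proj (x : ℝ × ℝ × ℝ × ℝ) : ℂ × ℂ := (fInv x 1, fInv x (1 / (x.2.1 : ℂ)))

/-- The continuation to all real `ũ`, `ṽ` with `ũ - ṽ ∉ 2πℤ` of
`p (w(iv)/(u-v) + k v) + (w(iu)/(u-v) - k u)`, `u = tan (ũ/2)`, `v = tan (ṽ/2)`;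
see `bracket_eq`. -/
def bracket (p k u v : ℝ) : ℝ :=
  p * (delta k v * Real.cot ((u - v) / 2)
      - (1 - k ^ 2) * (Real.sin (v / 2) * Real.cos (v / 2)) / (delta k v + k))
    + (delta k u * Real.cot ((u - v) / 2)
      + (1 - k ^ 2) * (Real.sin (u / 2) * Real.cos (u / 2)) / (delta k u + k))

/-- The single-valued lift `T̃` to the universal cover of the multi-valued function `T`. -/
def Ttilde (x : ℝ × ℝ × ℝ × ℝ) : ℝ :=
  match x with
  | (p, k, u, v) =>
    (4 * p * (ellipticE k * Ftilde v k - ellipticK k * Etilde v k)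
      - 4 * (ellipticE k * Ftilde u k - ellipticK k * Etilde u k)
      - 4 * ellipticK k * bracket p k u v) / (2 * Real.pi)

/-- `𝒜̃(p)`: the subset of the universal cover where `S ∘ π̃ = p`. -/
def coverS (p : ℝ) : Set (ℝ × ℝ × ℝ × ℝ) := {x ∈ cover | S (proj x) = p}

/-- `𝒜̃(p, q)`: the subset of `𝒜̃(p)` where `T̃ = q`. -/
def coverST (p q : ℝ) : Set (ℝ × ℝ × ℝ × ℝ) := {x ∈ coverS p | Ttilde x = q}

/-! ### Diffeomorphisms between subsets of normed spaces -/

/-- `f` is smooth on the arbitrary subset `X`: near each point of `X` it extends to a smooth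
function on an open set. -/
def SmoothOn {E F : Type*} [NormedAddCommGroup E] [NormedSpace ℝ E]
    [NormedAddCommGroup F] [NormedSpace ℝ F] (f : E → F) (X : Set E) : Prop :=
  ∀ x ∈ X, ∃ (U : Set E) (g : E → F), IsOpen U ∧ x ∈ U ∧ ContDiffOn ℝ ∞ g U ∧
    Set.EqOn f g (X ∩ U)

/-- `f` restricts to a diffeomorphism from `X` onto `Y`. -/
def IsDiffeoOn {E F : Type*} [NormedAddCommGroup E] [NormedSpace ℝ E]
    [NormedAddCommGroup F] [NormedSpace ℝ F] (f : E → F) (X : Set E) (Y : Set F) : Prop :=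
  Set.BijOn f X Y ∧ SmoothOn f X ∧ ∃ g : F → E, Set.InvOn g f X Y ∧ SmoothOn g Y

/-! ### The definitions agree with the formulae in `u = tan (ũ/2)`, `v = tan (ṽ/2)` -/

theorem delta_pos {k : ℝ} (hk : 0 < k) (s : ℝ) : 0 < delta k s := by
  unfold delta
  apply Real.sqrt_pos.2
  by_cases h : Real.cos (s / 2) = 0
  · have : Real.sin (s / 2) ^ 2 = 1 := by
      have := Real.sin_sq_add_cos_sq (s / 2); rw [h] at this; linarith
    rw [this]; positivity
  · positivity

theorem delta_sq (k s : ℝ) :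
    delta k s ^ 2 = Real.cos (s / 2) ^ 2 + k ^ 2 * Real.sin (s / 2) ^ 2 :=
  Real.sq_sqrt (by positivity)

/-- `w(i x) = √((1 + x²)(1 + k² x²))`. -/
def wI (k x : ℝ) : ℝ := √((1 + x ^ 2) * (1 + k ^ 2 * x ^ 2))

theorem wI_tan (k s : ℝ) (hs : Real.cos (s / 2) ≠ 0) :
    wI k (Real.tan (s / 2)) = delta k s / Real.cos (s / 2) ^ 2 := by
  have h1 : (1 + Real.tan (s / 2) ^ 2) * (1 + k ^ 2 * Real.tan (s / 2) ^ 2)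
      = (delta k s / Real.cos (s / 2) ^ 2) ^ 2 := by
    have h2 := Real.sin_sq_add_cos_sq (s / 2)
    rw [div_pow, delta_sq, Real.tan_eq_sin_div_cos]
    field_simp
    rw [add_comm (Real.cos (s / 2) ^ 2) (Real.sin (s / 2) ^ 2), h2]
  unfold wI
  rw [h1, Real.sqrt_sq]
  exact div_nonneg (Real.sqrt_nonneg _) (sq_nonneg _)

theorem bracket_eq {p k u v : ℝ} (hk : 0 < k)
    (hu : Real.cos (u / 2) ≠ 0) (hv : Real.cos (v / 2) ≠ 0)
    (huv : Real.sin ((u - v) / 2) ≠ 0) :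
    bracket p k u v =
      p * (wI k (Real.tan (v / 2)) / (Real.tan (u / 2) - Real.tan (v / 2))
          + k * Real.tan (v / 2))
        + (wI k (Real.tan (u / 2)) / (Real.tan (u / 2) - Real.tan (v / 2))
          - k * Real.tan (u / 2)) := by
  have hd := delta_pos hk u
  have he := delta_pos hk v
  have hd2 := delta_sq k u
  have he2 := delta_sq k v
  have h1 := Real.sin_sq_add_cos_sq (u / 2)
  have h2 := Real.sin_sq_add_cos_sq (v / 2)
  have hs : Real.sin ((u - v) / 2) =
      Real.sin (u / 2) * Real.cos (v / 2) - Real.cos (u / 2) * Real.sin (v / 2) := by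
    rw [sub_div, Real.sin_sub]
  have hc : Real.cos ((u - v) / 2) =
      Real.cos (u / 2) * Real.cos (v / 2) + Real.sin (u / 2) * Real.sin (v / 2) := by
    rw [sub_div, Real.cos_sub]
  rw [wI_tan k u hu, wI_tan k v hv]
  unfold bracket
  rw [Real.cot_eq_cos_div_sin, Real.tan_eq_sin_div_cos, Real.tan_eq_sin_div_cos]
  rw [hs] at huv
  rw [hc, hs]
  generalize Real.sin (u / 2) = a at *
  generalize Real.cos (u / 2) = b at *
  generalize Real.sin (v / 2) = c at *
  generalize Real.cos (v / 2) = d at *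
  generalize delta k u = X at *
  generalize delta k v = Y at *
  have e1 : a / b - c / d = (a * d - b * c) / (b * d) := by field_simp
  have g1 : (1 - k ^ 2) * (a * b) / (X + k) = (X - k) * a / b := by
    have : X + k ≠ 0 := by positivity
    field_simp
    linear_combination (-a) * hd2 - a * k ^ 2 * h1
  have g2 : (1 - k ^ 2) * (c * d) / (Y + k) = (Y - k) * c / d := by
    have : Y + k ≠ 0 := by positivity
    field_simp
    linear_combination (-c) * he2 - c * k ^ 2 * h2
  rw [e1, g1, g2]
  obtain ⟨s, hs'⟩ : ∃ s, s = a * d - b * c := ⟨_, rfl⟩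
  rw [← hs'] at huv ⊢
  have k1 : (b * d + a * c) / s - c / d = b / (d * s) := by
    field_simp
    rw [hs']
    linear_combination b * h2
  have k2 : (b * d + a * c) / s + a / b = d / (b * s) := by
    field_simp
    rw [hs']
    linear_combination d * h1
  have k3 : Y / d ^ 2 / (s / (b * d)) = Y * (b / (d * s)) := by field_simp
  have k4 : X / b ^ 2 / (s / (b * d)) = X * (d / (b * s)) := by field_simp
  rw [k3, k4, ← k1, ← k2]
  ring

theorem zZero_eq {p k u v : ℝ} (hp : 0 < p) (hk : 0 < k)
    (hu : Real.cos (u / 2) ≠ 0) (hv : Real.cos (v / 2) ≠ 0) :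
    zZero (p, k, u, v) =
      ((√(p * wI k (Real.tan (u / 2)) * wI k (Real.tan (v / 2)))
          / (p * wI k (Real.tan (v / 2)) + wI k (Real.tan (u / 2)))
          * |Real.tan (u / 2) - Real.tan (v / 2)| : ℝ) : ℂ)
      + Complex.I *
        (((p * Real.tan (u / 2) * wI k (Real.tan (v / 2))
            + Real.tan (v / 2) * wI k (Real.tan (u / 2)))
          / (p * wI k (Real.tan (v / 2)) + wI k (Real.tan (u / 2))) : ℝ) : ℂ) := by
  have hd := delta_pos hk u
  have he := delta_pos hk v
  have hsq : √(p * (delta k u / Real.cos (u / 2) ^ 2) * (delta k v / Real.cos (v / 2) ^ 2))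
      = √(p * delta k u * delta k v) / (|Real.cos (u / 2)| * |Real.cos (v / 2)|) := by
    rw [← abs_mul, ← Real.sqrt_sq_eq_abs, ← Real.sqrt_div' _ (by positivity)]
    congr 1
    field_simp
  have htan : |Real.tan (u / 2) - Real.tan (v / 2)|
      = |Real.sin (u / 2 - v / 2)| / (|Real.cos (u / 2)| * |Real.cos (v / 2)|) := by
    rw [← abs_mul, ← abs_div, Real.sin_sub, Real.tan_eq_sin_div_cos, Real.tan_eq_sin_div_cos]
    congr 1
    field_simp
  rw [htan, wI_tan k u hu, wI_tan k v hv, hsq, Real.tan_eq_sin_div_cos, Real.tan_eq_sin_div_cos]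
  have hD : 0 < p * delta k v * Real.cos (u / 2) ^ 2 + delta k u * Real.cos (v / 2) ^ 2 := by
    positivity
  have hu' : |Real.cos (u / 2)| ^ 2 = Real.cos (u / 2) ^ 2 := sq_abs _
  have hv' : |Real.cos (v / 2)| ^ 2 = Real.cos (v / 2) ^ 2 := sq_abs _
  have hua : 0 < |Real.cos (u / 2)| := abs_pos.2 hu
  have hva : 0 < |Real.cos (v / 2)| := abs_pos.2 hv
  have hD2 : p * (delta k v / Real.cos (v / 2) ^ 2) + delta k u / Real.cos (u / 2) ^ 2
      = (p * delta k v * Real.cos (u / 2) ^ 2 + delta k u * Real.cos (v / 2) ^ 2)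
        / (Real.cos (u / 2) ^ 2 * Real.cos (v / 2) ^ 2) := by
    field_simp
  rw [hD2]
  unfold zZero
  apply Complex.ext
  · simp only [Complex.div_ofReal_re, Complex.add_re, Complex.ofReal_re, Complex.mul_re,
      Complex.I_re, Complex.I_im, Complex.ofReal_im]
    rw [← hu', ← hv']
    rw [← hu', ← hv'] at hD
    generalize |Real.cos (u / 2)| = A at *
    generalize |Real.cos (v / 2)| = B at *
    field_simp
    ring
  · simp only [Complex.div_ofReal_im, Complex.add_im, Complex.ofReal_re, Complex.mul_im,
      Complex.I_re, Complex.I_im, Complex.ofReal_im]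
    field_simp
    ring

/-! ### `𝒜̃` is the universal cover of `𝒜` -/

/-- The Cayley transform, exchanging the unit disc and the right half-plane. -/
def cay (z : ℂ) : ℂ := (1 - z) / (1 + z)

theorem one_add_ne_zero_of_re {w : ℂ} (hw : 0 < w.re) : 1 + w ≠ 0 := fun h => by
  have := congrArg Complex.re h
  simp at this
  linarith

theorem one_add_ne_zero_of_norm {z : ℂ} (hz : ‖z‖ < 1) : 1 + z ≠ 0 := fun h => by
  have : z = -1 := by linear_combination h
  rw [this] at hz
  simp at hz

theorem cay_cay {z : ℂ} (h : 1 + z ≠ 0) : cay (cay z) = z := by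
  unfold cay
  have h2 : 1 + (1 - z) / (1 + z) = 2 / (1 + z) := by field_simp; ring
  rw [h2]
  field_simp
  ring

theorem cay_re_pos {z : ℂ} (hz : ‖z‖ < 1) : 0 < (cay z).re := by
  have h1 := one_add_ne_zero_of_norm hz
  have h2 : z.re ^ 2 + z.im ^ 2 < 1 := by
    have := Complex.sq_norm z
    rw [Complex.normSq_apply] at this
    nlinarith [norm_nonneg z]
  unfold cay
  rw [Complex.div_re, ← add_div]
  apply div_pos _ (Complex.normSq_pos.2 h1)
  simp
  nlinarith

theorem norm_cay_lt {w : ℂ} (hw : 0 < w.re) : ‖cay w‖ < 1 := by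
  have h1 := one_add_ne_zero_of_re hw
  unfold cay
  rw [norm_div, div_lt_one (norm_pos_iff.2 h1)]
  apply lt_of_pow_lt_pow_left₀ 2 (norm_nonneg _)
  rw [Complex.sq_norm, Complex.sq_norm, Complex.normSq_apply, Complex.normSq_apply]
  simp
  nlinarith

theorem S_eq (y : ℂ × ℂ) : S y = ‖cay y.1‖ * ‖cay y.2‖ := by
  unfold S cay
  rw [norm_div, norm_div]
  ring

/-- `cos (s/2) - i k sin (s/2)`. -/
def sig (k s : ℝ) : ℂ := Real.cos (s / 2) - Complex.I * k * Real.sin (s / 2)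

theorem norm_sig (k s : ℝ) : ‖sig k s‖ = delta k s := by
  unfold delta
  rw [Complex.norm_def]
  congr 1
  rw [Complex.normSq_apply]
  unfold sig
  generalize Real.cos (s / 2) = c
  generalize Real.sin (s / 2) = d
  simp
  ring

theorem sig_ne_zero {k : ℝ} (hk : 0 < k) (s : ℝ) : sig k s ≠ 0 := by
  rw [← norm_pos_iff, norm_sig]
  exact delta_pos hk s

/-- The images of `α` and `β` under `cay`, in terms of `(p, k, ũ, ṽ)`. -/
def hp (l : ℝ) (x : ℝ × ℝ × ℝ × ℝ) : ℂ :=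
  ((√(x.1 * delta x.2.1 x.2.2.2) / √(delta x.2.1 x.2.2.1) : ℝ) : ℂ) *
    (-Complex.I * sig l x.2.2.1 / sig l x.2.2.2)

theorem re_sig_div {l u v : ℝ} (hl : 0 < l) (h : 0 < Real.sin (v / 2 - u / 2)) :
    0 < (-Complex.I * sig l u / sig l v).re := by
  rw [Complex.div_re, ← add_div]
  apply div_pos _ (Complex.normSq_pos.2 (sig_ne_zero hl v))
  rw [Real.sin_sub] at h
  unfold sig
  generalize Real.cos (u / 2) = a at *
  generalize Real.sin (u / 2) = b at *
  generalize Real.cos (v / 2) = c at *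
  generalize Real.sin (v / 2) = d at *
  simp
  nlinarith

theorem sin_pos_of_mem {x : ℝ × ℝ × ℝ × ℝ} (hx : x ∈ cover) :
    0 < Real.sin (x.2.2.2 / 2 - x.2.2.1 / 2) := by
  obtain ⟨_, _, h1, h2⟩ := hx
  apply Real.sin_pos_of_pos_of_lt_pi <;> linarith

theorem hp_coeff_pos {x : ℝ × ℝ × ℝ × ℝ} (hx : x ∈ cover) :
    0 < √(x.1 * delta x.2.1 x.2.2.2) / √(delta x.2.1 x.2.2.1) := by
  have h1 := hx.1
  have h2 := delta_pos hx.2.1.1 x.2.2.1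
  have h3 := delta_pos hx.2.1.1 x.2.2.2
  positivity

theorem hp_re_pos {l : ℝ} (hl : 0 < l) {x : ℝ × ℝ × ℝ × ℝ} (hx : x ∈ cover) :
    0 < (hp l x).re := by
  unfold hp
  rw [Complex.re_ofReal_mul]
  exact mul_pos (hp_coeff_pos hx) (re_sig_div hl (sin_pos_of_mem hx))

theorem fInv_eq {l : ℝ} (hl : 0 < l) {x : ℝ × ℝ × ℝ × ℝ} (hx : x ∈ cover) :
    fInv x (1 / (l : ℂ)) = cay (hp l x) := by
  have hs := sin_pos_of_mem hx
  have hre := one_add_ne_zero_of_re (hp_re_pos hl hx)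
  have hlC : (l : ℂ) ≠ 0 := by exact_mod_cast hl.ne'
  obtain ⟨p, k, u, v⟩ := x
  have hk : 0 < k := hx.2.1.1
  have hp0 : 0 < p := hx.1
  have hd := delta_pos hk u
  have he := delta_pos hk v
  have hsv := sig_ne_zero hl v
  unfold fInv hp cay zZero
  unfold hp at hre
  simp only at hs hre ⊢
  have habs : |Real.sin (u / 2 - v / 2)| = Real.sin (v / 2 - u / 2) := by
    rw [← abs_neg, ← Real.sin_neg, neg_sub, abs_of_pos hs]
  have hsqrt : √(p * delta k u * delta k v) = √(p * delta k v) * √(delta k u) := by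
    rw [← Real.sqrt_mul (by positivity)]
    ring_nf
  rw [habs, hsqrt]
  have hP : 0 < √(p * delta k v) := by positivity
  have hQ : 0 < √(delta k u) := by positivity
  have hP2 : p * delta k v = √(p * delta k v) ^ 2 := (Real.sq_sqrt (by positivity)).symm
  have hQ2 : delta k u = √(delta k u) ^ 2 := (Real.sq_sqrt (by positivity)).symm
  obtain ⟨P, hPd⟩ : ∃ P, P = √(p * delta k v) := ⟨_, rfl⟩
  obtain ⟨Q, hQd⟩ : ∃ Q, Q = √(delta k u) := ⟨_, rfl⟩
  rw [← hPd] at hP2 hP hre ⊢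
  rw [← hQd] at hQ2 hQ hre ⊢
  rw [hP2, hQ2]
  have hsc := Real.sin_sub (v / 2) (u / 2)
  unfold sig at hsv hre ⊢
  generalize Real.sin (u / 2) = a at *
  generalize Real.cos (u / 2) = b at *
  generalize Real.sin (v / 2) = c at *
  generalize Real.cos (v / 2) = d at *
  generalize Real.sin (v / 2 - u / 2) = s at *
  have hh : (P * b + Complex.I * Q * d : ℂ) ≠ 0 := by
    intro h
    have h1 := congrArg Complex.re h
    have h2 := congrArg Complex.im h
    simp at h1 h2
    have hb : b = 0 := by rcases h1 with h1 | h1 <;> [exact absurd h1 hP.ne'; exact h1]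
    have hdd : d = 0 := by rcases h2 with h2 | h2 <;> [exact absurd h2 hQ.ne'; exact h2]
    rw [hb, hdd] at hsc
    simp at hsc
    linarith
  have hh' : (P * b - Complex.I * Q * d : ℂ) ≠ 0 := by
    intro h
    apply hh
    have := congrArg (starRingEnd ℂ) h
    simpa [sub_eq_add_neg] using this
  have hI := Complex.I_sq
  have hz : ((⟨P * Q * s, P ^ 2 * (a * b) + Q ^ 2 * (c * d)⟩ : ℂ) /
      ((P ^ 2 * b ^ 2 + Q ^ 2 * d ^ 2 : ℝ) : ℂ)) =
      (Q * c + Complex.I * P * a) / (P * b - Complex.I * Q * d) := by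
    have e1 : ((P ^ 2 * b ^ 2 + Q ^ 2 * d ^ 2 : ℝ) : ℂ)
        = (P * b + Complex.I * Q * d) * (P * b - Complex.I * Q * d) := by
      push_cast
      linear_combination (Q ^ 2 * d ^ 2 : ℂ) * hI
    have e2 : (⟨P * Q * s, P ^ 2 * (a * b) + Q ^ 2 * (c * d)⟩ : ℂ)
        = (P * b + Complex.I * Q * d) * (Q * c + Complex.I * P * a) := by
      apply Complex.ext <;> simp [hsc] <;> ring
    rw [e1, e2]
    field_simp
  rw [hz]
  have hzc : (starRingEnd ℂ) ((Q * c + Complex.I * P * a) / (P * b - Complex.I * Q * d) : ℂ)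
      = (Q * c - Complex.I * P * a) / (P * b + Complex.I * Q * d) := by
    simp [sub_eq_add_neg]
  rw [hzc]
  have hscC : (s : ℂ) = c * b - d * a := by rw [hsc]; push_cast; ring
  have hsC : (s : ℂ) ≠ 0 := by exact_mod_cast hs.ne'
  have hPC : (P : ℂ) ≠ 0 := by exact_mod_cast hP.ne'
  have hQC : (Q : ℂ) ≠ 0 := by exact_mod_cast hQ.ne'
  have n1 : Complex.I * a + (Q * c - Complex.I * P * a) / (P * b + Complex.I * Q * d) * b
      = Q * s / (P * b + Complex.I * Q * d) := by
    field_simp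
    rw [hscC]
    linear_combination (Q * a * d : ℂ) * hI
  have n2 : Complex.I * a - (Q * c + Complex.I * P * a) / (P * b - Complex.I * Q * d) * b
      = -(Q * s) / (P * b - Complex.I * Q * d) := by
    field_simp
    rw [hscC]
    linear_combination (-Q * a * d : ℂ) * hI
  rw [n1, n2]
  push_cast
  obtain ⟨A, hA⟩ : ∃ A : ℂ, A = b - Complex.I * l * a := ⟨_, rfl⟩
  obtain ⟨B, hB⟩ : ∃ B : ℂ, B = d - Complex.I * l * c := ⟨_, rfl⟩
  push_cast at hre hsv
  rw [← hB] at hre hsv ⊢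
  rw [← hA] at hre ⊢
  have m0 : Complex.I * Q * B + P * A ≠ 0 := by
    intro h
    apply hre
    field_simp
    linear_combination (-Complex.I) * h + (Q * B) * hI
  have m1 : 1 + (P / Q : ℂ) * (-Complex.I * A / B)
      = (Complex.I * Q * B + P * A) / (Complex.I * Q * B) := by
    field_simp
    linear_combination (-(P * A)) * hI
  have m2 : 1 - (P / Q : ℂ) * (-Complex.I * A / B)
      = (Complex.I * Q * B - P * A) / (Complex.I * Q * B) := by
    field_simp
    linear_combination ((P * A)) * hI
  rw [m1, m2]
  have n3 : (1 / (l : ℂ)) - (Q * c + Complex.I * P * a) / (P * b - Complex.I * Q * d)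
      = -(Complex.I * Q * B - P * A) / (l * (P * b - Complex.I * Q * d)) := by
    rw [hA, hB, div_sub_div _ _ hlC hh']
    congr 1
    linear_combination (-(Q * l * c : ℂ)) * hI
  have n4 : (1 / (l : ℂ)) + (Q * c - Complex.I * P * a) / (P * b + Complex.I * Q * d)
      = (Complex.I * Q * B + P * A) / (l * (P * b + Complex.I * Q * d)) := by
    rw [hA, hB, div_add_div _ _ hlC hh]
    congr 1
    linear_combination (Q * l * c : ℂ) * hI
  rw [n3, n4]
  have hIC := Complex.I_ne_zero
  generalize Complex.I * Q * B + P * A = R1 at *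
  generalize Complex.I * Q * B - P * A = R2 at *
  generalize (P * b + Complex.I * Q * d : ℂ) = R3 at *
  generalize (P * b - Complex.I * Q * d : ℂ) = R4 at *
  field_simp

theorem proj_eq {x : ℝ × ℝ × ℝ × ℝ} (hx : x ∈ cover) :
    proj x = (cay (hp 1 x), cay (hp x.2.1 x)) := by
  unfold proj
  rw [← fInv_eq one_pos hx, ← fInv_eq hx.2.1.1 hx]
  simp

theorem cay_proj {x : ℝ × ℝ × ℝ × ℝ} (hx : x ∈ cover) :
    cay (proj x).1 = hp 1 x ∧ cay (proj x).2 = hp x.2.1 x := by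
  rw [proj_eq hx]
  exact ⟨cay_cay (one_add_ne_zero_of_re (hp_re_pos one_pos hx)),
    cay_cay (one_add_ne_zero_of_re (hp_re_pos hx.2.1.1 hx))⟩

theorem sig_one (s : ℝ) : sig 1 s = (Complex.exp ((s / 2 : ℝ) * Complex.I))⁻¹ := by
  rw [← Complex.exp_neg, ← neg_mul, ← Complex.ofReal_neg, Complex.exp_mul_I]
  unfold sig
  push_cast
  rw [Complex.cos_neg, Complex.sin_neg]
  ring

theorem sig_mul (k s : ℝ) (hk : 0 < k) :
    sig k s * Complex.exp ((s / 2 : ℝ) * Complex.I) = (1 + k) / 2 *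
      (1 + ((1 - k) / (1 + k)) * Complex.exp ((s / 2 : ℝ) * Complex.I) ^ 2) := by
  have hk1 : (1 + k : ℂ) ≠ 0 := by exact_mod_cast (by positivity : (1 + k : ℝ) ≠ 0)
  have h1 := Real.sin_sq_add_cos_sq (s / 2)
  have h2 : (Real.sin (s / 2) ^ 2 + Real.cos (s / 2) ^ 2 : ℂ) = 1 := by exact_mod_cast h1
  rw [Complex.exp_mul_I, ← Complex.ofReal_cos, ← Complex.ofReal_sin]
  unfold sig
  generalize (Real.sin (s / 2) : ℂ) = c at *
  generalize (Real.cos (s / 2) : ℂ) = d at *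
  have hI := Complex.I_sq
  field_simp
  linear_combination (k + 1) * h2 + (-(c ^ 2)) * (1 + k) * hI

/-- The ratio in `hp`. -/
def rad (x : ℝ × ℝ × ℝ × ℝ) : ℝ := √(x.1 * delta x.2.1 x.2.2.2) / √(delta x.2.1 x.2.2.1)

theorem hp_one (x : ℝ × ℝ × ℝ × ℝ) :
    hp 1 x = rad x * (-Complex.I * (Complex.exp ((x.2.2.2 / 2 : ℝ) * Complex.I) /
      Complex.exp ((x.2.2.1 / 2 : ℝ) * Complex.I))) := by
  unfold hp rad
  rw [sig_one, sig_one]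
  have := Complex.exp_ne_zero ((x.2.2.2 / 2 : ℝ) * Complex.I)
  have := Complex.exp_ne_zero ((x.2.2.1 / 2 : ℝ) * Complex.I)
  field_simp

theorem hp_one' (x : ℝ × ℝ × ℝ × ℝ) :
    hp 1 x = rad x *
      Complex.exp ((x.2.2.2 / 2 - x.2.2.1 / 2 - Real.pi / 2 : ℝ) * Complex.I) := by
  rw [hp_one]
  congr 1
  push_cast
  rw [sub_mul, sub_mul, Complex.exp_sub, Complex.exp_sub, Complex.exp_pi_div_two_mul_I]
  have := Complex.I_ne_zero
  have := Complex.exp_ne_zero ((x.2.2.1 / 2 : ℂ) * Complex.I)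
  field_simp
  linear_combination (-1 : ℂ) * Complex.I_sq

theorem arg_hp_one {x : ℝ × ℝ × ℝ × ℝ} (hx : x ∈ cover) :
    Complex.arg (hp 1 x) = x.2.2.2 / 2 - x.2.2.1 / 2 - Real.pi / 2 := by
  rw [hp_one', Complex.arg_real_mul _ (show 0 < rad x from hp_coeff_pos hx), Complex.exp_mul_I,
    Complex.arg_cos_add_sin_mul_I]
  obtain ⟨_, _, h1, h2⟩ := hx
  constructor <;> linarith [Real.pi_pos]

theorem one_add_ne {k s : ℝ} (hk : 0 < k) :
    (1 + ((1 - k) / (1 + k)) * Complex.exp ((s / 2 : ℝ) * Complex.I) ^ 2 : ℂ) ≠ 0 := by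
  intro h
  have h1 := sig_mul k s hk
  rw [h, mul_zero] at h1
  exact mul_ne_zero (sig_ne_zero hk s) (Complex.exp_ne_zero _) h1

theorem hp_k {x : ℝ × ℝ × ℝ × ℝ} (hx : x ∈ cover) :
    hp x.2.1 x = hp 1 x *
      ((1 + ((1 - x.2.1) / (1 + x.2.1)) * Complex.exp ((x.2.2.1 / 2 : ℝ) * Complex.I) ^ 2) /
      (1 + ((1 - x.2.1) / (1 + x.2.1)) * Complex.exp ((x.2.2.2 / 2 : ℝ) * Complex.I) ^ 2)) := by
  have hk := hx.2.1.1
  have h1 := sig_mul x.2.1 x.2.2.1 hk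
  have h2 := sig_mul x.2.1 x.2.2.2 hk
  have h3 := one_add_ne (s := x.2.2.1) hk
  have h4 := one_add_ne (s := x.2.2.2) hk
  have h5 := Complex.exp_ne_zero ((x.2.2.2 / 2 : ℝ) * Complex.I)
  have h6 := Complex.exp_ne_zero ((x.2.2.1 / 2 : ℝ) * Complex.I)
  have hk1 : ((1 + x.2.1) / 2 : ℂ) ≠ 0 := by
    exact_mod_cast (by positivity : ((1 + x.2.1) / 2 : ℝ) ≠ 0)
  have h7 := sig_ne_zero hk x.2.2.2
  rw [hp_one]
  unfold hp rad
  generalize (1 + ((1 - x.2.1) / (1 + x.2.1)) *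
    Complex.exp ((x.2.2.1 / 2 : ℝ) * Complex.I) ^ 2 : ℂ) = a at *
  generalize (1 + ((1 - x.2.1) / (1 + x.2.1)) *
    Complex.exp ((x.2.2.2 / 2 : ℝ) * Complex.I) ^ 2 : ℂ) = b at *
  generalize Complex.exp ((x.2.2.2 / 2 : ℝ) * Complex.I) = g at *
  generalize Complex.exp ((x.2.2.1 / 2 : ℝ) * Complex.I) = e at *
  generalize ((1 + x.2.1) / 2 : ℂ) = m at *
  have e1 : sig x.2.1 x.2.2.1 = m * a / e := by field_simp; exact h1
  have e2 : sig x.2.1 x.2.2.2 = m * b / g := by field_simp; exact h2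
  rw [e1, e2]
  field_simp

/-- For `A`, `B` the images of `α`, `β` in the half-plane this is `(1-k)/(1+k) · e^{iũ}`. -/
def wFun (A B : ℂ) : ℂ := (B - A) * starRingEnd ℂ A / (A * (starRingEnd ℂ A + B))

theorem wFun_hp {x : ℝ × ℝ × ℝ × ℝ} (hx : x ∈ cover) :
    wFun (hp 1 x) (hp x.2.1 x) =
      ((1 - x.2.1) / (1 + x.2.1) : ℝ) * Complex.exp (x.2.2.1 * Complex.I) := by
  have hk := hx.2.1.1
  have hk1 := hx.2.1.2
  have hr : (rad x : ℂ) ≠ 0 := by exact_mod_cast (hp_coeff_pos hx).ne'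
  have h3 := one_add_ne (s := x.2.2.1) hk
  have h4 := one_add_ne (s := x.2.2.2) hk
  have h5 := Complex.exp_ne_zero ((x.2.2.2 / 2 : ℝ) * Complex.I)
  have h6 := Complex.exp_ne_zero ((x.2.2.1 / 2 : ℝ) * Complex.I)
  have hre := hp_re_pos one_pos hx
  have hne : Complex.exp ((x.2.2.2 / 2 : ℝ) * Complex.I) ^ 2
      - Complex.exp ((x.2.2.1 / 2 : ℝ) * Complex.I) ^ 2 ≠ 0 := by
    intro h
    have hs := sin_pos_of_mem hx
    rw [sub_eq_zero, ← Complex.exp_nat_mul, ← Complex.exp_nat_mul, Complex.exp_eq_exp_iff_exists_int] at h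
    obtain ⟨n, hn⟩ := h
    have h2 : x.2.2.2 = x.2.2.1 + n * (2 * Real.pi) := by
      have := congrArg Complex.im hn
      simp at this
      linarith
    have h7 : x.2.2.2 / 2 - x.2.2.1 / 2 = n * Real.pi := by rw [h2]; ring
    rw [h7, Real.sin_int_mul_pi] at hs
    exact lt_irrefl _ hs
  have hexp : Complex.exp (x.2.2.1 * Complex.I)
      = Complex.exp ((x.2.2.1 / 2 : ℝ) * Complex.I) ^ 2 := by
    rw [← Complex.exp_nat_mul]
    congr 1
    push_cast
    ring
  have hconj : starRingEnd ℂ (hp 1 x) = rad x * (Complex.I *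
      (Complex.exp ((x.2.2.1 / 2 : ℝ) * Complex.I) /
      Complex.exp ((x.2.2.2 / 2 : ℝ) * Complex.I))) := by
    rw [hp_one]
    simp only [map_mul, map_div₀, map_neg, Complex.conj_I, Complex.conj_ofReal,
      ← Complex.exp_conj, neg_neg, mul_neg, Complex.exp_neg]
    have := Complex.exp_ne_zero ((x.2.2.2 / 2 : ℝ) * Complex.I)
    have := Complex.exp_ne_zero ((x.2.2.1 / 2 : ℝ) * Complex.I)
    field_simp
  unfold wFun
  rw [hp_k hx, hexp, hconj, hp_one]
  push_cast
  push_cast at h3 h4 h5 h6 hne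
  generalize Complex.exp ((x.2.2.2 / 2 : ℂ) * Complex.I) = g at *
  generalize Complex.exp ((x.2.2.1 / 2 : ℂ) * Complex.I) = e at *
  generalize ((1 - x.2.1) / (1 + x.2.1) : ℂ) = c at *
  generalize (rad x : ℂ) = r at *
  have hI := Complex.I_ne_zero
  obtain ⟨n, hn⟩ : ∃ n, n = 1 + c * g ^ 2 := ⟨_, rfl⟩
  rw [← hn] at h4 ⊢
  have q1 : r * (Complex.I * (e / g)) + r * (-Complex.I * (g / e)) *
      ((1 + c * e ^ 2) / n) =
      -(r * Complex.I * (g ^ 2 - e ^ 2) / (g * e * n)) := by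
    field_simp
    rw [hn]
    ring
  have q2 : r * (-Complex.I * (g / e)) * ((1 + c * e ^ 2) / n) -
      r * (-Complex.I * (g / e)) = r * Complex.I * g * c * (g ^ 2 - e ^ 2) / (e * n) := by
    field_simp
    rw [hn]
    ring
  rw [q1, q2]
  generalize g ^ 2 - e ^ 2 = m at *
  field_simp

theorem mapsTo_proj : Set.MapsTo proj cover curveSpace := by
  intro x hx
  obtain ⟨c1, c2⟩ := cay_proj hx
  have h1 := hp_re_pos one_pos hx
  refine ⟨?_, ?_, ?_⟩
  · rw [proj_eq hx]; exact norm_cay_lt h1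
  · rw [proj_eq hx]; exact norm_cay_lt (hp_re_pos hx.2.1.1 hx)
  · intro h
    rw [h, c2] at c1
    have hw := wFun_hp hx
    rw [c1] at hw
    have hpos : 0 < (1 - x.2.1) / (1 + x.2.1) :=
      div_pos (by linarith [hx.2.1.2]) (by linarith [hx.2.1.1])
    have : wFun (hp 1 x) (hp 1 x) = 0 := by simp [wFun]
    rw [this] at hw
    exact mul_ne_zero (by exact_mod_cast hpos.ne') (Complex.exp_ne_zero _) hw.symm

/-- In the coordinates `(p, k, ũ, ṽ)` the function `S ∘ π̃` is `p`. -/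
theorem S_proj {x : ℝ × ℝ × ℝ × ℝ} (hx : x ∈ cover) : S (proj x) = x.1 := by
  obtain ⟨c1, c2⟩ := cay_proj hx
  rw [S_eq, c1, c2]
  have hk := hx.2.1.1
  have hp0 := hx.1
  have hd := delta_pos hk x.2.2.1
  have he := delta_pos hk x.2.2.2
  unfold hp
  rw [norm_mul, norm_mul, norm_div, norm_div, norm_mul, norm_mul, sig_one, sig_one,
    norm_inv, norm_inv, Complex.norm_exp_ofReal_mul_I, Complex.norm_exp_ofReal_mul_I, norm_sig,
    norm_sig, norm_neg, Complex.norm_I, Complex.norm_real, Real.norm_of_nonneg (by positivity)]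
  have h1 := Real.sq_sqrt (show 0 ≤ x.1 * delta x.2.1 x.2.2.2 by positivity)
  have h2 := Real.sq_sqrt hd.le
  generalize √(x.1 * delta x.2.1 x.2.2.2) = P at *
  have : √(delta x.2.1 x.2.2.1) ≠ 0 := by positivity
  generalize √(delta x.2.1 x.2.2.1) = Q at *
  rw [← h2]
  field_simp
  linear_combination h1

theorem wFun_aux {A B : ℂ} (hA : 0 < A.re) (hB : 0 < B.re) (hAB : A ≠ B) :
    A ≠ 0 ∧ B ≠ 0 ∧ starRingEnd ℂ A ≠ 0 ∧ starRingEnd ℂ A + B ≠ 0 ∧ A + starRingEnd ℂ A ≠ 0 ∧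
      wFun A B ≠ 0 ∧ ‖wFun A B‖ < 1 := by
  have a0 : A ≠ 0 := fun h => by simp [h] at hA
  have b0 : B ≠ 0 := fun h => by simp [h] at hB
  have ac : starRingEnd ℂ A ≠ 0 := (map_ne_zero _).2 a0
  have s0 : starRingEnd ℂ A + B ≠ 0 := fun h => by
    have := congrArg Complex.re h
    simp at this
    linarith
  have s1 : A + starRingEnd ℂ A ≠ 0 := fun h => by
    have := congrArg Complex.re h
    simp at this
    linarith
  refine ⟨a0, b0, ac, s0, s1, ?_, ?_⟩
  · exact div_ne_zero (mul_ne_zero (sub_ne_zero.2 hAB.symm) ac) (mul_ne_zero a0 s0)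
  · unfold wFun
    rw [norm_div, norm_mul, norm_mul, Complex.norm_conj, mul_comm ‖A‖,
      mul_div_mul_right _ _ (norm_ne_zero_iff.2 a0), div_lt_one (norm_pos_iff.2 s0)]
    apply lt_of_pow_lt_pow_left₀ 2 (norm_nonneg _)
    rw [Complex.sq_norm, Complex.sq_norm, Complex.normSq_apply, Complex.normSq_apply]
    simp
    nlinarith

/-- The point of `𝒜̃` over `cay A`, `cay B` with `ũ = t`, provided that `t` is a lift. -/
def sect (A B : ℂ) (t : ℝ) : ℝ × ℝ × ℝ × ℝ :=
  (‖A‖ * ‖B‖, (1 - ‖wFun A B‖) / (1 + ‖wFun A B‖), t, t + (2 * Complex.arg A + Real.pi))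

theorem sect_mem {A B : ℂ} (hA : 0 < A.re) (hB : 0 < B.re) (hAB : A ≠ B) (t : ℝ) :
    sect A B t ∈ cover := by
  obtain ⟨a0, b0, ac, s0, s1, w0, w1⟩ := wFun_aux hA hB hAB
  have hw := norm_pos_iff.2 w0
  have harg := abs_lt.1 (Complex.abs_arg_lt_pi_div_two_iff.2 (Or.inl hA))
  refine ⟨?_, ⟨?_, ?_⟩, ?_, ?_⟩ <;> simp only [sect]
  · exact mul_pos (norm_pos_iff.2 a0) (norm_pos_iff.2 b0)
  · exact div_pos (by linarith) (by linarith)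
  · rw [div_lt_one (by linarith)]; linarith
  · linarith [harg.1]
  · linarith [harg.2]

theorem kappa_eq {r : ℝ} (hr : 0 < r) :
    (1 - (1 - r) / (1 + r)) / (1 + (1 - r) / (1 + r)) = r := by
  have : (1 + r) ≠ 0 := by positivity
  have h2 : 1 + (1 - r) / (1 + r) = 2 / (1 + r) := by field_simp; ring
  rw [h2]
  field_simp
  ring

theorem hp_sect {A B : ℂ} (hA : 0 < A.re) (hB : 0 < B.re) (hAB : A ≠ B) (t : ℝ)
    (ht : Complex.exp (t * Complex.I) = wFun A B / ‖wFun A B‖) :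
    hp 1 (sect A B t) = A ∧ hp (sect A B t).2.1 (sect A B t) = B := by
  have hx := sect_mem hA hB hAB t
  obtain ⟨a0, b0, ac, s0, s1, w0, w1⟩ := wFun_aux hA hB hAB
  have hw := norm_pos_iff.2 w0
  have hwC : (‖wFun A B‖ : ℂ) ≠ 0 := by exact_mod_cast hw.ne'
  have hAn : (‖A‖ : ℂ) ≠ 0 := by exact_mod_cast (norm_pos_iff.2 a0).ne'
  have hr : 0 < rad (sect A B t) := hp_coeff_pos hx
  have h1 : hp 1 (sect A B t) = (rad (sect A B t) / ‖A‖ : ℝ) * A := by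
    rw [hp_one']
    have : (sect A B t).2.2.2 / 2 - (sect A B t).2.2.1 / 2 - Real.pi / 2 = Complex.arg A := by
      simp only [sect]; ring
    rw [this]
    have h2 := Complex.norm_mul_exp_arg_mul_I A
    push_cast
    field_simp
    linear_combination (rad (sect A B t) : ℂ) * h2
  have hk : (((1 - (sect A B t).2.1) / (1 + (sect A B t).2.1) : ℂ)) = ‖wFun A B‖ := by
    exact_mod_cast kappa_eq hw
  have eu : (((1 - (sect A B t).2.1) / (1 + (sect A B t).2.1) : ℂ)) *
      Complex.exp (((sect A B t).2.2.1 / 2 : ℝ) * Complex.I) ^ 2 = wFun A B := by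
    rw [hk, ← Complex.exp_nat_mul]
    have : ((2 : ℕ) : ℂ) * (((sect A B t).2.2.1 / 2 : ℝ) * Complex.I) = t * Complex.I := by
      simp only [sect]; push_cast; ring
    rw [this, ht]
    field_simp
  have hAA : A / starRingEnd ℂ A = Complex.exp (Complex.arg A * Complex.I) ^ 2 := by
    have h2 := Complex.norm_mul_exp_arg_mul_I A
    have h3 : starRingEnd ℂ A = ‖A‖ * (Complex.exp (Complex.arg A * Complex.I))⁻¹ := by
      conv_lhs => rw [← h2]
      rw [map_mul, Complex.conj_ofReal, ← Complex.exp_conj, map_mul, Complex.conj_ofReal,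
        Complex.conj_I, mul_neg, Complex.exp_neg]
    have h4 := Complex.exp_ne_zero (Complex.arg A * Complex.I)
    rw [div_eq_iff ac, h3]
    field_simp
    rw [mul_comm]
    exact h2.symm
  have ev : (((1 - (sect A B t).2.1) / (1 + (sect A B t).2.1) : ℂ)) *
      Complex.exp (((sect A B t).2.2.2 / 2 : ℝ) * Complex.I) ^ 2
      = -(wFun A B * (A / starRingEnd ℂ A)) := by
    rw [hk, ← Complex.exp_nat_mul]
    have : ((2 : ℕ) : ℂ) * (((sect A B t).2.2.2 / 2 : ℝ) * Complex.I)
        = t * Complex.I + ((2 : ℕ) * (Complex.arg A * Complex.I) + Real.pi * Complex.I) := by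
      simp only [sect]; push_cast; ring
    rw [this, Complex.exp_add, Complex.exp_add, ht, Complex.exp_pi_mul_I, hAA,
      Complex.exp_nat_mul]
    field_simp
  have h2 : hp (sect A B t).2.1 (sect A B t) = (rad (sect A B t) / ‖A‖ : ℝ) * B := by
    rw [hp_k hx, h1, eu, ev]
    have q1 : 1 + wFun A B = B * (A + starRingEnd ℂ A) / (A * (starRingEnd ℂ A + B)) := by
      unfold wFun; field_simp; ring
    have q2 : 1 + -(wFun A B * (A / starRingEnd ℂ A))
        = (A + starRingEnd ℂ A) / (starRingEnd ℂ A + B) := by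
      unfold wFun; field_simp; ring
    rw [q1, q2]
    field_simp
  have h3 := S_proj hx
  obtain ⟨c1, c2⟩ := cay_proj hx
  rw [S_eq, c1, c2, h1, h2, norm_mul, norm_mul, Complex.norm_real,
    Real.norm_of_nonneg (by positivity)] at h3
  have hnA := norm_pos_iff.2 a0
  have hnB := norm_pos_iff.2 b0
  have h4 : (rad (sect A B t) / ‖A‖) ^ 2 = 1 := by
    have : (sect A B t).1 = ‖A‖ * ‖B‖ := rfl
    rw [this] at h3
    have h5 : 0 < ‖A‖ * ‖B‖ := mul_pos hnA hnB
    apply mul_right_cancel₀ h5.ne'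
    linear_combination h3
  have h5 : rad (sect A B t) / ‖A‖ = 1 := by
    have : 0 < rad (sect A B t) / ‖A‖ := by positivity
    nlinarith
  rw [h1, h2, h5]
  simp

theorem sect_hp {x : ℝ × ℝ × ℝ × ℝ} (hx : x ∈ cover) :
    sect (hp 1 x) (hp x.2.1 x) x.2.2.1 = x := by
  have h1 := S_proj hx
  obtain ⟨c1, c2⟩ := cay_proj hx
  rw [S_eq, c1, c2] at h1
  have hpos : 0 < (1 - x.2.1) / (1 + x.2.1) :=
    div_pos (by linarith [hx.2.1.2]) (by linarith [hx.2.1.1])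
  have hw : ‖wFun (hp 1 x) (hp x.2.1 x)‖ = (1 - x.2.1) / (1 + x.2.1) := by
    rw [wFun_hp hx, norm_mul, Complex.norm_exp_ofReal_mul_I, Complex.norm_real,
      Real.norm_of_nonneg hpos.le, mul_one]
  unfold sect
  rw [h1, hw, kappa_eq hx.2.1.1, arg_hp_one hx]
  ext <;> simp
  ring

/-- A continuous map that is the pullback of a covering map is a covering map. -/
theorem isCoveringMap_of_pullback {E X E' X' : Type*} [TopologicalSpace E] [TopologicalSpace X]
    [TopologicalSpace E'] [TopologicalSpace X'] {f : E → X} (hf : Continuous f)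
    {c : E' → X'} (hc : IsCoveringMap c) {g : X → X'} (hg : Continuous g)
    {t : E → E'} (ht : Continuous t) (hct : ∀ e, c (t e) = g (f e))
    {s : X → E' → E} (hs : Continuous fun z : {z : X × E' // c z.2 = g z.1} => s z.1.1 z.1.2)
    (h1 : ∀ x e, c e = g x → f (s x e) = x) (h2 : ∀ x e, c e = g x → t (s x e) = e)
    (h3 : ∀ e, s (f e) (t e) = e) : IsCoveringMap f := by
  intro x
  obtain ⟨hd, U, hxU, hU, hcU, H, hH⟩ := hc (g x)
  have key : IsEvenlyCovered f x (c ⁻¹' {g x}) := by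
    refine ⟨hd, g ⁻¹' U, hxU, hU.preimage hg, (hU.preimage hg).preimage hf, ?_⟩
    have hz : ∀ z : (g ⁻¹' U) × (c ⁻¹' {g x}),
        c (H.symm (⟨g z.1, z.1.2⟩, z.2)).1 = g z.1 := fun z => by
      rw [← hH, H.apply_symm_apply]
    refine ⟨{
      toFun := fun e => (⟨f e, e.2⟩, (H ⟨t e, by
        change c (t e) ∈ U
        rw [hct]; exact e.2⟩).2)
      invFun := fun z => ⟨s z.1 (H.symm (⟨g z.1, z.1.2⟩, z.2)).1, by
        change g (f _) ∈ U
        rw [h1 _ _ (hz z)]; exact z.1.2⟩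
      left_inv := ?_
      right_inv := ?_
      continuous_toFun := by fun_prop
      continuous_invFun := ?_ }, fun e => rfl⟩
    · intro e
      have he : c (t e) ∈ U := by rw [hct]; exact e.2
      have : H ⟨t e, he⟩ = (⟨g (f e), e.2⟩, (H ⟨t e, he⟩).2) := by
        refine Prod.ext (Subtype.ext ?_) rfl
        rw [hH]
        exact hct e
      apply Subtype.ext
      simp only
      rw [← this, H.symm_apply_apply]
      exact h3 e
    · intro z
      apply Prod.ext
      · exact Subtype.ext (h1 _ _ (hz z))
      · simp only
        have : ∀ (w : E') (hw : c w ∈ U), w = (H.symm (⟨g z.1, z.1.2⟩, z.2)).1 →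
            (H ⟨w, hw⟩).2 = z.2 := by
          intro w hw hwe
          subst hwe
          have : (⟨(H.symm (⟨g z.1, z.1.2⟩, z.2)).1, hw⟩ : c ⁻¹' U)
            = H.symm (⟨g z.1, z.1.2⟩, z.2) := rfl
          rw [this, H.apply_symm_apply]
        exact this _ _ (h2 _ _ (hz z))
    · apply Continuous.subtype_mk
      have hcont : Continuous fun z : (g ⁻¹' U) × (c ⁻¹' {g x}) =>
          (⟨(z.1.1, (H.symm (⟨g z.1, z.1.2⟩, z.2)).1), hz z⟩ :
            {z : X × E' // c z.2 = g z.1}) := by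
        apply Continuous.subtype_mk
        fun_prop
      exact hs.comp hcont
  exact key.to_isEvenlyCovered_preimage

theorem continuousOn_delta : ContinuousOn
    (fun x : ℝ × ℝ × ℝ × ℝ => (delta x.2.1 x.2.2.1, delta x.2.1 x.2.2.2)) cover := by
  unfold delta
  fun_prop

theorem continuousOn_proj : ContinuousOn proj cover := by
  have hcont : ∀ l : (ℝ × ℝ × ℝ × ℝ) → ℝ, Continuous l → (∀ x ∈ cover, 0 < l x) →
      ContinuousOn (fun x => cay (hp (l x) x)) cover := by
    intro l hl hpos
    have h1 : ContinuousOn (fun x => hp (l x) x) cover := by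
      unfold hp
      apply ContinuousOn.mul
      · apply Complex.continuous_ofReal.comp_continuousOn
        apply ContinuousOn.div
        · unfold delta; fun_prop
        · unfold delta; fun_prop
        · intro x hx
          exact (Real.sqrt_pos.2 (delta_pos hx.2.1.1 _)).ne'
      · apply ContinuousOn.div
        · unfold sig; fun_prop
        · unfold sig; fun_prop
        · intro x hx
          exact sig_ne_zero (hpos x hx) _
    unfold cay
    apply ContinuousOn.div (by fun_prop) (by fun_prop)
    intro x hx
    exact one_add_ne_zero_of_re (hp_re_pos (hpos x hx) hx)
  apply ContinuousOn.congr (f := fun x => (cay (hp 1 x), cay (hp x.2.1 x)))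
  · exact (hcont (fun _ => 1) continuous_const fun _ _ => one_pos).prodMk
      (hcont (fun x => x.2.1) (by fun_prop) fun x hx => hx.2.1.1)
  · intro x hx
    exact proj_eq hx

/-- `π̃ : 𝒜̃ → 𝒜` is a covering map. -/
theorem isCoveringMap_proj : IsCoveringMap mapsTo_proj.restrict := by
  have hre : ∀ y : curveSpace, 0 < (cay y.1.1).re ∧ 0 < (cay y.1.2).re ∧
      cay y.1.1 ≠ cay y.1.2 := fun y => by
    refine ⟨cay_re_pos y.2.1, cay_re_pos y.2.2.1, fun h => y.2.2.2 ?_⟩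
    rw [← cay_cay (one_add_ne_zero_of_norm y.2.1), h,
      cay_cay (one_add_ne_zero_of_norm y.2.2.1)]
  have hc1 : Continuous fun y : curveSpace => cay y.1.1 := by
    unfold cay
    exact Continuous.div (by fun_prop) (by fun_prop) fun y => one_add_ne_zero_of_norm y.2.1
  have hc2 : Continuous fun y : curveSpace => cay y.1.2 := by
    unfold cay
    exact Continuous.div (by fun_prop) (by fun_prop) fun y => one_add_ne_zero_of_norm y.2.2.1
  have hw : ∀ y : curveSpace, wFun (cay y.1.1) (cay y.1.2) ≠ 0 := fun y =>
    (wFun_aux (hre y).1 (hre y).2.1 (hre y).2.2).2.2.2.2.2.1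
  have hcw : Continuous fun y : curveSpace => wFun (cay y.1.1) (cay y.1.2) := by
    unfold wFun
    refine Continuous.div (by fun_prop) (by fun_prop) fun y => ?_
    obtain ⟨a0, -, -, s0, -⟩ := wFun_aux (hre y).1 (hre y).2.1 (hre y).2.2
    exact mul_ne_zero a0 s0
  have hnorm : ∀ y : curveSpace,
      ‖wFun (cay y.1.1) (cay y.1.2) / ‖wFun (cay y.1.1) (cay y.1.2)‖‖ = 1 := fun y => by
    rw [norm_div, Complex.norm_real, norm_norm, div_self (norm_ne_zero_iff.2 (hw y))]
  let g : curveSpace → Circle := fun y =>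
    ⟨wFun (cay y.1.1) (cay y.1.2) / ‖wFun (cay y.1.1) (cay y.1.2)‖,
      mem_sphere_zero_iff_norm.2 (hnorm y)⟩
  have hg : Continuous g := by
    apply Continuous.subtype_mk
    refine Continuous.div hcw (by fun_prop) fun y => ?_
    exact_mod_cast norm_ne_zero_iff.2 (hw y)
  refine isCoveringMap_of_pullback (c := Circle.exp) (g := g) (t := fun x : cover => x.1.2.2.1)
    (s := fun y t => ⟨sect (cay y.1.1) (cay y.1.2) t,
      sect_mem (hre y).1 (hre y).2.1 (hre y).2.2 t⟩)
    (continuousOn_proj.mapsToRestrict mapsTo_proj) Circle.isCoveringMap_exp hg (by fun_prop)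
    ?_ ?_ ?_ ?_ ?_
  · intro x
    apply Subtype.ext
    change Complex.exp _ = wFun (cay (proj x.1).1) (cay (proj x.1).2) /
      ‖wFun (cay (proj x.1).1) (cay (proj x.1).2)‖
    obtain ⟨c1, c2⟩ := cay_proj x.2
    have hpos : 0 < (1 - x.1.2.1) / (1 + x.1.2.1) :=
      div_pos (by linarith [x.2.2.1.2]) (by linarith [x.2.2.1.1])
    have hC : (((1 - x.1.2.1) / (1 + x.1.2.1) : ℝ) : ℂ) ≠ 0 := by exact_mod_cast hpos.ne'
    rw [c1, c2, wFun_hp x.2, norm_mul, Complex.norm_exp_ofReal_mul_I, Complex.norm_real,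
      Real.norm_of_nonneg hpos.le, mul_one, mul_div_cancel_left₀ _ hC]
  · apply Continuous.subtype_mk
    unfold sect
    have harg : Continuous fun y : curveSpace => Complex.arg (cay y.1.1) :=
      continuous_iff_continuousAt.2 fun y =>
        ContinuousAt.comp (f := fun y : curveSpace => cay y.1.1) (x := y)
          (Complex.continuousAt_arg (Or.inl (hre y).1)) hc1.continuousAt
    have hk : Continuous fun y : curveSpace => (1 - ‖wFun (cay y.1.1) (cay y.1.2)‖) /
        (1 + ‖wFun (cay y.1.1) (cay y.1.2)‖) :=
      Continuous.div (by fun_prop) (by fun_prop) fun y => by positivity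
    have hp' : Continuous fun y : curveSpace => ‖cay y.1.1‖ * ‖cay y.1.2‖ := by fun_prop
    exact (hp'.comp (by fun_prop : Continuous fun z : {z : curveSpace × ℝ //
      Circle.exp z.2 = g z.1} => z.1.1)).prodMk
      ((hk.comp (by fun_prop)).prodMk ((by fun_prop : Continuous _).prodMk
        ((by fun_prop : Continuous fun z : {z : curveSpace × ℝ //
          Circle.exp z.2 = g z.1} => z.1.2).add
          (((harg.comp (by fun_prop : Continuous fun z : {z : curveSpace × ℝ //
      Circle.exp z.2 = g z.1} => z.1.1)).const_mul 2).add continuous_const))))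
  · intro y t hyt
    have ht : Complex.exp (t * Complex.I) =
      wFun (cay y.1.1) (cay y.1.2) / ‖wFun (cay y.1.1) (cay y.1.2)‖ := congrArg Subtype.val hyt
    obtain ⟨e1, e2⟩ := hp_sect (hre y).1 (hre y).2.1 (hre y).2.2 t ht
    apply Subtype.ext
    change proj (sect (cay y.1.1) (cay y.1.2) t) = y.1
    rw [proj_eq (sect_mem (hre y).1 (hre y).2.1 (hre y).2.2 t), e1, e2,
      cay_cay (one_add_ne_zero_of_norm y.2.1), cay_cay (one_add_ne_zero_of_norm y.2.2.1)]
  · intro y t _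
    rfl
  · intro x
    apply Subtype.ext
    change sect (cay (proj x.1).1) (cay (proj x.1).2) x.1.2.2.1 = x.1
    obtain ⟨c1, c2⟩ := cay_proj x.2
    rw [c1, c2, sect_hp x.2]

/-- `π̃ : 𝒜̃ → 𝒜` is surjective. -/
theorem surjOn_proj : Set.SurjOn proj cover curveSpace := by
  rintro y ⟨h1, h2, h3⟩
  have hne : cay y.1 ≠ cay y.2 := fun h => h3 <| by
    rw [← cay_cay (one_add_ne_zero_of_norm h1), h, cay_cay (one_add_ne_zero_of_norm h2)]
  have hA := cay_re_pos h1
  have hB := cay_re_pos h2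
  obtain ⟨-, -, -, -, -, w0, -⟩ := wFun_aux hA hB hne
  have hw : (‖wFun (cay y.1) (cay y.2)‖ : ℂ) ≠ 0 := by exact_mod_cast norm_ne_zero_iff.2 w0
  obtain ⟨e1, e2⟩ := hp_sect hA hB hne (Complex.arg (wFun (cay y.1) (cay y.2))) (by
    rw [eq_div_iff hw, mul_comm]
    exact Complex.norm_mul_exp_arg_mul_I _)
  refine ⟨_, sect_mem hA hB hne (Complex.arg (wFun (cay y.1) (cay y.2))), ?_⟩
  rw [proj_eq (sect_mem hA hB hne _), e1, e2, cay_cay (one_add_ne_zero_of_norm h1),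
    cay_cay (one_add_ne_zero_of_norm h2)]

/-- `𝒜̃` is simply connected. -/
theorem simplyConnectedSpace_cover : SimplyConnectedSpace cover := by
  have hconv : Convex ℝ cover := by
    rintro x ⟨a1, ⟨a2, a3⟩, a4, a5⟩ y ⟨b1, ⟨b2, b3⟩, b4, b5⟩ a b ha hb hab
    have hb' : b = 1 - a := by linarith
    have key : ∀ r s : ℝ, 0 < r → 0 < s → 0 < a * r + b * s := by
      intro r s hr hs
      rcases ha.eq_or_lt with h | h
      · rw [← h] at hb' ⊢; rw [hb']; linarith
      · have := mul_pos h hr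
        have := mul_nonneg hb hs.le
        linarith
    refine ⟨key _ _ a1 b1, ⟨key _ _ a2 b2, ?_⟩, ?_, ?_⟩ <;>
      simp only [Prod.fst_add, Prod.snd_add, Prod.smul_fst, Prod.smul_snd, smul_eq_mul]
    · have := key (1 - x.2.1) (1 - y.2.1) (by linarith) (by linarith)
      nlinarith
    · have := key (x.2.2.2 - x.2.2.1) (y.2.2.2 - y.2.2.1) (by linarith) (by linarith)
      nlinarith
    · have := key (x.2.2.1 + 2 * Real.pi - x.2.2.2) (y.2.2.1 + 2 * Real.pi - y.2.2.2)
        (by linarith) (by linarith)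
      have h2 : 2 * Real.pi = a * (2 * Real.pi) + b * (2 * Real.pi) := by
        rw [← add_mul, hab, one_mul]
      nlinarith
  have hne : cover.Nonempty := ⟨(1, 1 / 2, 0, 1), by
    refine ⟨one_pos, ⟨by norm_num, by norm_num⟩, by norm_num, ?_⟩
    have := Real.pi_gt_three
    simp only
    linarith⟩
  have := hconv.contractibleSpace hne
  infer_instance

end

end GenusOne

namespace GenusOne

open MeasureTheory Set Filter Topology

universe w

/-! In the coordinates `(p, k, ũ, ṽ)` the function `S ∘ π̃` is just `p` (`S_proj`), so `𝒜̃(p)` is a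
slice of the open set `cover`. It then suffices to show that for `p ≤ 1` and fixed `k`, `ũ` the
function `ṽ ↦ T̃` is a decreasing bijection from `(ũ, ũ + 2π)` onto `ℝ` with nowhere vanishing
derivative.

The derivative (`hasDerivAt_Ttilde`) is a negative factor times `p (K - E) sin²((ũ-ṽ)/2) + K (p
cos((ũ-ṽ)/2) C + δ(ũ) δ(ṽ))`, where `C` is the inner product of the vectors `(cos, k sin)` at `ũ/2`
and `ṽ/2`, and `δ` (`delta`) is their length. Since `E ≤ K`, `|C| ≤ δ(ũ) δ(ṽ)` by Cauchy–Schwarz,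
and `|p cos((ũ-ṽ)/2)| < 1`, the sum is positive (`deriv_Ttilde_neg`). The cotangent terms drive `T̃`
to `+∞` as `ṽ → ũ` and to `-∞` as `ṽ → ũ + 2π`, so every value `q` is taken exactly once
(`existsUnique_Ttilde_eq`). The implicit function theorem makes the solution `ṽ` smooth in `(q, k,
ũ)` jointly (`exists_contDiffOn_solution`). This one function gives both the inverse diffeomorphism
and, with `q` frozen, the graph.

For `p ≥ 1` the symmetry `(p, ũ, ṽ) ↦ (1/p, -ṽ, -ũ)`, which changes `T̃` only by the factor `p`
(`Ttilde_symm`), reduces everything to the first case. -/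

/-! ### Integrals depending on a parameter, and smoothness of implicit solutions. -/

theorem hasFDerivAt_intervalIntegral_param {E G : Type*} [NormedAddCommGroup E]
    [NormedSpace ℝ E] [ProperSpace E] [NormedAddCommGroup G] [NormedSpace ℝ G]
    {U : Set E} (hU : IsOpen U) {f : E × ℝ → G} (hf : ContDiffOn ℝ 1 f (U ×ˢ univ))
    (a b : ℝ) {x : E} (hx : x ∈ U) :
    HasFDerivAt (fun y => ∫ t in a..b, f (y, t))
      (∫ t in a..b, (fderiv ℝ f (x, t)).comp (ContinuousLinearMap.inl ℝ E ℝ)) x := by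
  have hO : IsOpen (U ×ˢ (univ : Set ℝ)) := hU.prod isOpen_univ
  have hc' : ContinuousOn (fun z : E × ℝ =>
      (fderiv ℝ f z).comp (ContinuousLinearMap.inl ℝ E ℝ)) (U ×ˢ univ) :=
    (hf.continuousOn_fderiv_of_isOpen hO le_rfl).clm_comp continuousOn_const
  have hslice : ∀ y ∈ U, Continuous fun t : ℝ => f (y, t) := fun y hy =>
    hf.continuousOn.comp_continuous (by fun_prop) fun t => ⟨hy, mem_univ _⟩
  -- On a compact neighbourhood of `x` times the compact range of `t` the partial derivative is
  -- bounded, so a constant serves as the dominating function.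
  obtain ⟨N, hNc, hxN, hNU⟩ := exists_compact_subset hU hx
  obtain ⟨C, hC⟩ := (hNc.prod (isCompact_uIcc (a := a) (b := b))).exists_bound_of_continuousOn
    (hc'.mono (prod_mono hNU (subset_univ _)))
  refine intervalIntegral.hasFDerivAt_integral_of_dominated_of_fderiv_le (𝕜 := ℝ) (s := N)
    (bound := fun _ => C) (F' := fun y t => (fderiv ℝ f (y, t)).comp
      (ContinuousLinearMap.inl ℝ E ℝ)) (mem_interior_iff_mem_nhds.1 hxN) ?_
    ((hslice x hx).intervalIntegrable _ _) ?_ ?_ (by simp) ?_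
  · filter_upwards [hU.mem_nhds hx] with y hy
    exact (hslice y hy).aestronglyMeasurable
  · exact Continuous.aestronglyMeasurable
      (hc'.comp_continuous (by fun_prop) fun t => ⟨hx, mem_univ _⟩)
  · exact Eventually.of_forall fun t ht y hy => hC (y, t) ⟨hy, uIoc_subset_uIcc ht⟩
  · refine Eventually.of_forall fun t _ y hy => ?_
    have h1 : HasFDerivAt f (fderiv ℝ f (y, t)) (y, t) :=
      ((hf.differentiableOn one_ne_zero).differentiableAt
        (hO.mem_nhds ⟨hNU hy, mem_univ _⟩)).hasFDerivAt
    exact h1.comp y (hasFDerivAt_prodMk_left y t)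

/-- The derivative is again an integral of this kind, with values in `E →L[ℝ] G`, so induction on
the order of differentiability works if `G` is allowed to vary. The common universe of `E` and `G`
keeps `E →L[ℝ] G` within reach of the induction hypothesis. -/
theorem contDiffOn_intervalIntegral_param {E G : Type w} [NormedAddCommGroup E]
    [NormedSpace ℝ E] [ProperSpace E] [NormedAddCommGroup G] [NormedSpace ℝ G]
    {U : Set E} (hU : IsOpen U) {f : E × ℝ → G} (hf : ContDiffOn ℝ ∞ f (U ×ˢ univ))
    (a b : ℝ) : ContDiffOn ℝ ∞ (fun y => ∫ t in a..b, f (y, t)) U := by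
  rw [contDiffOn_infty]
  intro n
  induction n generalizing G with
  | zero =>
    rw [Nat.cast_zero, contDiffOn_zero]
    exact fun x hx => (hasFDerivAt_intervalIntegral_param hU (hf.of_le (by simp)) a b
      hx).continuousAt.continuousWithinAt
  | succ n ih =>
    have hd := fun x hx => hasFDerivAt_intervalIntegral_param hU (hf.of_le (by simp)) a b
      (x := x) hx
    rw [Nat.cast_succ, contDiffOn_succ_iff_fderiv_of_isOpen hU]
    refine ⟨fun x hx => (hd x hx).differentiableAt.differentiableWithinAt, by simp, ?_⟩
    refine (ih (f := fun z => (fderiv ℝ f z).comp (ContinuousLinearMap.inl ℝ E ℝ)) ?_).congr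
      fun x hx => (hd x hx).fderiv
    exact ((contDiffOn_infty_iff_fderiv_of_isOpen (hU.prod isOpen_univ)).1 hf).2.clm_comp
      contDiffOn_const

/-- A function that is the unique solution of an implicit equation with non-vanishing partial
derivative is smooth. -/
theorem contDiffOn_of_unique_solution {E : Type*} [NormedAddCommGroup E] [NormedSpace ℝ E]
    [CompleteSpace E] {f : E × ℝ → ℝ} {Ω : Set (E × ℝ)} (hΩ : IsOpen Ω)
    (hf : ContDiffOn ℝ ∞ f Ω) (hd : ∀ z ∈ Ω, deriv (fun v => f (z.1, v)) z.2 ≠ 0)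
    {U : Set E} (hU : IsOpen U) {g : E → ℝ} (hg : ∀ x ∈ U, (x, g x) ∈ Ω ∧ f (x, g x) = 0)
    (huniq : ∀ x ∈ U, ∀ v, (x, v) ∈ Ω → f (x, v) = 0 → v = g x) : ContDiffOn ℝ ∞ g U := by
  intro x hx
  apply ContDiffAt.contDiffWithinAt
  obtain ⟨hm, h0⟩ := hg x hx
  have hfx : ContDiffAt ℝ ∞ f (x, g x) := hf.contDiffAt (hΩ.mem_nhds hm)
  have hderiv : HasDerivAt (fun v => f (x, v))
      ((fderiv ℝ f (x, g x)).comp (ContinuousLinearMap.inr ℝ E ℝ) 1) (g x) :=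
    ((hfx.differentiableAt (by simp)).hasFDerivAt.comp (g x)
      (hasFDerivAt_prodMk_right x (g x))).hasDerivAt
  have hne : (fderiv ℝ f (x, g x)).comp (ContinuousLinearMap.inr ℝ E ℝ) 1 ≠ 0 := by
    rw [← hderiv.deriv]
    exact hd _ hm
  -- A linear map `ℝ → ℝ` is multiplication by its value at `1`, hence invertible once that value is
  -- nonzero.
  have hinv : ((fderiv ℝ f (x, g x)).comp (ContinuousLinearMap.inr ℝ E ℝ)).IsInvertible := by
    refine ⟨ContinuousLinearEquiv.unitsEquivAut ℝ (Units.mk0 _ hne), ?_⟩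
    ext
    simp
  have hsm := hfx.contDiffAt_implicitFunction (by simp) hinv
  refine hsm.congr_of_eventuallyEq ?_
  have htend : Tendsto (fun y => (y, hfx.implicitFunction (by simp) hinv y)) (𝓝 x)
      (𝓝 (x, g x)) := by
    have := (continuousAt_id.prodMk hsm.continuousAt).tendsto
    rwa [hfx.implicitFunction_apply_self (by simp) hinv] at this
  -- Continuity of `g` is not assumed. The graph of the implicit function stays in `Ω` near `x` and
  -- solves the equation there, so uniqueness identifies it with `g`.
  filter_upwards [hU.mem_nhds hx, htend.eventually (hΩ.mem_nhds hm),
    hfx.eventually_apply_implicitFunction (by simp) hinv] with y hy hyΩ hy0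
  exact (huniq y hy _ hyΩ (hy0.trans h0)).symm

/-! ### Smoothness of the elliptic integrals and of `T̃`. -/

theorem contDiffOn_delta :
    ContDiffOn ℝ ∞ (fun z : ℝ × ℝ => delta z.1 z.2) (Ioi 0 ×ˢ univ) := by
  unfold delta
  refine ContDiffOn.sqrt (by fun_prop) fun z hz => ?_
  rw [← delta_sq]
  exact (pow_pos (delta_pos hz.1 z.2) 2).ne'

theorem one_sub_sq_mul_sin_sq_pos {k : ℝ} (hk : k ∈ Ioo (0 : ℝ) 1) (θ : ℝ) :
    0 < 1 - k ^ 2 * Real.sin θ ^ 2 := by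
  have h1 := Real.sin_sq_le_one θ
  have h2 : k ^ 2 < 1 := by nlinarith [hk.1, hk.2]
  nlinarith [sq_nonneg (Real.sin θ), sq_nonneg k]

theorem contDiffOn_sqrt_one_sub : ContDiffOn ℝ ∞
    (fun z : ℝ × ℝ => √(1 - z.1 ^ 2 * Real.sin z.2 ^ 2)) (Ioo 0 1 ×ˢ univ) :=
  ContDiffOn.sqrt (by fun_prop) fun z hz => (one_sub_sq_mul_sin_sq_pos hz.1 z.2).ne'

theorem contDiffOn_ellipticE : ContDiffOn ℝ ∞ ellipticE (Ioo 0 1) :=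
  contDiffOn_intervalIntegral_param isOpen_Ioo contDiffOn_sqrt_one_sub _ _

theorem contDiffOn_ellipticK : ContDiffOn ℝ ∞ ellipticK (Ioo 0 1) :=
  contDiffOn_intervalIntegral_param isOpen_Ioo
    (f := fun z : ℝ × ℝ => 1 / √(1 - z.1 ^ 2 * Real.sin z.2 ^ 2))
    (contDiffOn_const.div contDiffOn_sqrt_one_sub fun z hz =>
      (Real.sqrt_pos.2 (one_sub_sq_mul_sin_sq_pos hz.1 z.2)).ne') _ _

theorem continuous_sqrt_one_sub (k : ℝ) :
    Continuous fun θ => √(1 - k ^ 2 * Real.sin θ ^ 2) := by fun_prop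

theorem continuous_one_div_sqrt_one_sub {k : ℝ} (hk : k ∈ Ioo (0 : ℝ) 1) :
    Continuous fun θ => 1 / √(1 - k ^ 2 * Real.sin θ ^ 2) :=
  continuous_const.div (continuous_sqrt_one_sub k) fun θ =>
    (Real.sqrt_pos.2 (one_sub_sq_mul_sin_sq_pos hk θ)).ne'

theorem ellipticK_pos {k : ℝ} (hk : k ∈ Ioo (0 : ℝ) 1) : 0 < ellipticK k :=
  intervalIntegral.intervalIntegral_pos_of_pos
    ((continuous_one_div_sqrt_one_sub hk).intervalIntegrable _ _)
    (fun θ => one_div_pos.2 (Real.sqrt_pos.2 (one_sub_sq_mul_sin_sq_pos hk θ)))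
    Real.pi_div_two_pos

/-- The integrands are `r` and `1/r` with `0 < r ≤ 1`. The inequality fixes the sign of the `K - E`
term in the derivative of `T̃`. -/
theorem ellipticE_le_ellipticK {k : ℝ} (hk : k ∈ Ioo (0 : ℝ) 1) : ellipticE k ≤ ellipticK k := by
  refine intervalIntegral.integral_mono Real.pi_div_two_pos.le
    ((continuous_sqrt_one_sub k).intervalIntegrable _ _)
    ((continuous_one_div_sqrt_one_sub hk).intervalIntegrable _ _) fun θ => ?_
  have h := one_sub_sq_mul_sin_sq_pos hk θ
  have h2 : √(1 - k ^ 2 * Real.sin θ ^ 2) ≤ 1 :=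
    Real.sqrt_le_one.2 (by nlinarith [mul_nonneg (sq_nonneg k) (sq_nonneg (Real.sin θ))])
  exact h2.trans (one_le_one_div (Real.sqrt_pos.2 h) h2)

/-- Rescaling to the fixed interval `[0, 1]` turns a moving endpoint into one more parameter of the
integrand, so that smooth dependence on parameters also covers the upper limit. -/
theorem integral_zero_eq_mul (f : ℝ → ℝ) (s : ℝ) :
    ∫ t in (0 : ℝ)..s, f t = s * ∫ t in (0 : ℝ)..1, f (s * t) := by
  simp

/-- Smoothness of `(s, k) ↦ ∫₀ˢ f(k, t) dt`. -/
theorem contDiffOn_primitive {f : ℝ × ℝ → ℝ} {I : Set ℝ} (hI : IsOpen I)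
    (hf : ContDiffOn ℝ ∞ f (I ×ˢ univ)) :
    ContDiffOn ℝ ∞ (fun z : ℝ × ℝ => ∫ t in (0 : ℝ)..z.1, f (z.2, t)) (univ ×ˢ I) := by
  simp_rw [integral_zero_eq_mul fun t => f (_, t)]
  refine contDiffOn_fst.mul (contDiffOn_intervalIntegral_param (isOpen_univ.prod hI)
    (f := fun z : (ℝ × ℝ) × ℝ => f (z.1.2, z.1.1 * z.2)) ?_ 0 1)
  exact hf.comp (by fun_prop) fun z hz => ⟨hz.1.2, mem_univ _⟩

theorem contDiffOn_Ftilde :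
    ContDiffOn ℝ ∞ (fun z : ℝ × ℝ => Ftilde z.1 z.2) (univ ×ˢ Ioi 0) :=
  contDiffOn_const.mul (contDiffOn_primitive (f := fun z => 1 / delta z.1 z.2) isOpen_Ioi
    (contDiffOn_const.div contDiffOn_delta fun z hz => (delta_pos hz.1 z.2).ne'))

theorem contDiffOn_Etilde :
    ContDiffOn ℝ ∞ (fun z : ℝ × ℝ => Etilde z.1 z.2) (univ ×ˢ Ioi 0) := by
  refine ContDiffOn.mul (by fun_prop) (contDiffOn_primitive
    (f := fun z => 1 / (delta z.1 z.2 + z.1)) isOpen_Ioi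
    (contDiffOn_const.div (contDiffOn_delta.add contDiffOn_fst) fun z hz => ?_))
  exact (add_pos (delta_pos hz.1 z.2) hz.1).ne'

theorem isOpen_cover : IsOpen cover := by
  have : cover = {x : ℝ × ℝ × ℝ × ℝ | 0 < x.1} ∩ ({x | 0 < x.2.1} ∩ {x | x.2.1 < 1}) ∩
      ({x | x.2.2.1 < x.2.2.2} ∩ {x | x.2.2.2 < x.2.2.1 + 2 * Real.pi}) := by
    ext x
    simp [cover, and_assoc]
  rw [this]
  exact ((isOpen_lt (by fun_prop) (by fun_prop)).inter ((isOpen_lt (by fun_prop)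
    (by fun_prop)).inter (isOpen_lt (by fun_prop) (by fun_prop)))).inter
    ((isOpen_lt (by fun_prop) (by fun_prop)).inter (isOpen_lt (by fun_prop) (by fun_prop)))

theorem sin_neg_of_mem {x : ℝ × ℝ × ℝ × ℝ} (hx : x ∈ cover) :
    Real.sin ((x.2.2.1 - x.2.2.2) / 2) < 0 := by
  have h := sin_pos_of_mem hx
  rw [← neg_neg ((x.2.2.1 - x.2.2.2) / 2), Real.sin_neg]
  have : -((x.2.2.1 - x.2.2.2) / 2) = x.2.2.2 / 2 - x.2.2.1 / 2 := by ring
  rw [this]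
  linarith

theorem contDiffOn_Ttilde : ContDiffOn ℝ ∞ Ttilde cover := by
  have hk0 : ∀ x ∈ cover, x.2.1 ∈ Ioi (0 : ℝ) := fun x hx => hx.2.1.1
  have hK : ContDiffOn ℝ ∞ (fun x : ℝ × ℝ × ℝ × ℝ => ellipticK x.2.1) cover :=
    contDiffOn_ellipticK.comp (by fun_prop) fun x hx => hx.2.1
  have hE : ContDiffOn ℝ ∞ (fun x : ℝ × ℝ × ℝ × ℝ => ellipticE x.2.1) cover :=
    contDiffOn_ellipticE.comp (by fun_prop) fun x hx => hx.2.1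
  have hFu : ContDiffOn ℝ ∞ (fun x : ℝ × ℝ × ℝ × ℝ => Ftilde x.2.2.1 x.2.1) cover :=
    contDiffOn_Ftilde.comp (f := fun x : ℝ × ℝ × ℝ × ℝ => (x.2.2.1, x.2.1)) (by fun_prop)
      fun x hx => ⟨mem_univ _, hk0 x hx⟩
  have hFv : ContDiffOn ℝ ∞ (fun x : ℝ × ℝ × ℝ × ℝ => Ftilde x.2.2.2 x.2.1) cover :=
    contDiffOn_Ftilde.comp (f := fun x : ℝ × ℝ × ℝ × ℝ => (x.2.2.2, x.2.1)) (by fun_prop)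
      fun x hx => ⟨mem_univ _, hk0 x hx⟩
  have hEu : ContDiffOn ℝ ∞ (fun x : ℝ × ℝ × ℝ × ℝ => Etilde x.2.2.1 x.2.1) cover :=
    contDiffOn_Etilde.comp (f := fun x : ℝ × ℝ × ℝ × ℝ => (x.2.2.1, x.2.1)) (by fun_prop)
      fun x hx => ⟨mem_univ _, hk0 x hx⟩
  have hEv : ContDiffOn ℝ ∞ (fun x : ℝ × ℝ × ℝ × ℝ => Etilde x.2.2.2 x.2.1) cover :=
    contDiffOn_Etilde.comp (f := fun x : ℝ × ℝ × ℝ × ℝ => (x.2.2.2, x.2.1)) (by fun_prop)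
      fun x hx => ⟨mem_univ _, hk0 x hx⟩
  have hdu : ContDiffOn ℝ ∞ (fun x : ℝ × ℝ × ℝ × ℝ => delta x.2.1 x.2.2.1) cover :=
    contDiffOn_delta.comp (f := fun x : ℝ × ℝ × ℝ × ℝ => (x.2.1, x.2.2.1)) (by fun_prop)
      fun x hx => ⟨hk0 x hx, mem_univ _⟩
  have hdv : ContDiffOn ℝ ∞ (fun x : ℝ × ℝ × ℝ × ℝ => delta x.2.1 x.2.2.2) cover :=
    contDiffOn_delta.comp (f := fun x : ℝ × ℝ × ℝ × ℝ => (x.2.1, x.2.2.2)) (by fun_prop)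
      fun x hx => ⟨hk0 x hx, mem_univ _⟩
  have hcot : ContDiffOn ℝ ∞
      (fun x : ℝ × ℝ × ℝ × ℝ => Real.cot ((x.2.2.1 - x.2.2.2) / 2)) cover := by
    -- On the cover `(ũ - ṽ)/2` lies in `(-π, 0)`, where the sine has no zero.
    simp_rw [Real.cot_eq_cos_div_sin]
    exact ContDiffOn.div (by fun_prop) (by fun_prop) fun x hx => (sin_neg_of_mem hx).ne
  have hgu : ContDiffOn ℝ ∞ (fun x : ℝ × ℝ × ℝ × ℝ => (1 - x.2.1 ^ 2) *
      (Real.sin (x.2.2.1 / 2) * Real.cos (x.2.2.1 / 2)) / (delta x.2.1 x.2.2.1 + x.2.1)) cover :=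
    ContDiffOn.div (by fun_prop) (hdu.add (by fun_prop)) fun x hx =>
      (add_pos (delta_pos (hk0 x hx) _) (hk0 x hx)).ne'
  have hgv : ContDiffOn ℝ ∞ (fun x : ℝ × ℝ × ℝ × ℝ => (1 - x.2.1 ^ 2) *
      (Real.sin (x.2.2.2 / 2) * Real.cos (x.2.2.2 / 2)) / (delta x.2.1 x.2.2.2 + x.2.1)) cover :=
    ContDiffOn.div (by fun_prop) (hdv.add (by fun_prop)) fun x hx =>
      (add_pos (delta_pos (hk0 x hx) _) (hk0 x hx)).ne'
  have hb : ContDiffOn ℝ ∞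
      (fun x : ℝ × ℝ × ℝ × ℝ => bracket x.1 x.2.1 x.2.2.1 x.2.2.2) cover :=
    (contDiffOn_fst.mul ((hdv.mul hcot).sub hgv)).add ((hdu.mul hcot).add hgu)
  exact ((((contDiffOn_const.mul contDiffOn_fst).mul ((hE.mul hFv).sub (hK.mul hEv))).sub
    (contDiffOn_const.mul ((hE.mul hFu).sub (hK.mul hEu)))).sub
    ((contDiffOn_const.mul hK).mul hb)).div_const _

/-! ### The partial derivative of `T̃` in `ṽ` and its sign. -/

theorem continuous_delta (k : ℝ) : Continuous (delta k) := by
  unfold delta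
  fun_prop

theorem hasDerivAt_delta {k : ℝ} (hk : 0 < k) (s : ℝ) :
    HasDerivAt (delta k)
      (-(1 - k ^ 2) * (Real.sin (s / 2) * Real.cos (s / 2)) / (2 * delta k s)) s := by
  have h2 : HasDerivAt (fun t : ℝ => t / 2) (1 / 2) s := (hasDerivAt_id s).div_const 2
  have h := ((h2.cos.pow 2).add ((h2.sin.pow 2).const_mul (k ^ 2))).sqrt
    (by simpa [delta_sq] using (pow_pos (delta_pos hk s) 2).ne')
  refine h.congr_deriv ?_
  change _ / (2 * delta k s) = _
  congr 1
  push_cast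
  ring

theorem hasDerivAt_Ftilde {k : ℝ} (hk : 0 < k) (s : ℝ) :
    HasDerivAt (fun s => Ftilde s k) (1 / 2 * (1 / delta k s)) s := by
  have hc : Continuous fun t => 1 / delta k t :=
    continuous_const.div (continuous_delta k) fun t => (delta_pos hk t).ne'
  exact (hc.integral_hasStrictDerivAt 0 s).hasDerivAt.const_mul _

theorem hasDerivAt_Etilde {k : ℝ} (hk : 0 < k) (s : ℝ) :
    HasDerivAt (fun s => Etilde s k) (1 / 2 * (1 - k ^ 2) * (1 / (delta k s + k))) s := by
  have hc : Continuous fun t => 1 / (delta k t + k) :=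
    continuous_const.div ((continuous_delta k).add continuous_const) fun t =>
      (add_pos (delta_pos hk t) hk).ne'
  exact (hc.integral_hasStrictDerivAt 0 s).hasDerivAt.const_mul _

/-- The derivative is split so that its first term is exactly the derivative of `Ẽ`; the two cancel
when `T̃` is differentiated, and only denominators `delta k s` remain. -/
theorem hasDerivAt_sin_mul_cos_div {k : ℝ} (hk : 0 < k) (s : ℝ) :
    HasDerivAt (fun s => (1 - k ^ 2) * (Real.sin (s / 2) * Real.cos (s / 2)) / (delta k s + k))
      (1 / 2 * (1 - k ^ 2) * (1 / (delta k s + k) - Real.sin (s / 2) ^ 2 / delta k s)) s := by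
  have h2 : HasDerivAt (fun t : ℝ => t / 2) (1 / 2) s := (hasDerivAt_id s).div_const 2
  have hd := delta_pos hk s
  have hd2 := delta_sq k s
  have h1 := Real.sin_sq_add_cos_sq (s / 2)
  have h := ((h2.sin.mul h2.cos).const_mul (1 - k ^ 2)).div ((hasDerivAt_delta hk s).add_const k)
    (add_pos hd hk).ne'
  refine h.congr_deriv ?_
  simp only [Pi.mul_apply]
  generalize delta k s = d at *
  generalize Real.sin (s / 2) = a at *
  generalize Real.cos (s / 2) = c at *
  have : d + k ≠ 0 := by positivity
  field_simp
  linear_combination (1 - k ^ 2) * (d * (d + k) * h1 - a ^ 2 * hd2 - a ^ 2 * k ^ 2 * h1)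

theorem hasDerivAt_cot_sub {u v : ℝ} (h : Real.sin ((u - v) / 2) ≠ 0) :
    HasDerivAt (fun v => Real.cot ((u - v) / 2)) (1 / (2 * Real.sin ((u - v) / 2) ^ 2)) v := by
  simp_rw [Real.cot_eq_cos_div_sin]
  have h2 : HasDerivAt (fun t : ℝ => (u - t) / 2) (-1 / 2) v :=
    ((hasDerivAt_id v).const_sub u).div_const 2
  refine (h2.cos.div h2.sin h).congr_deriv ?_
  have h1 := Real.sin_sq_add_cos_sq ((u - v) / 2)
  field_simp
  linear_combination h1

/-- The partial derivative of `T̃` in the direction of `ṽ`. -/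
theorem hasDerivAt_Ttilde {p k u v : ℝ} (hk : 0 < k) (h : Real.sin ((u - v) / 2) ≠ 0) :
    HasDerivAt (fun v => Ttilde (p, k, u, v))
      (-(p * (ellipticK k - ellipticE k) * Real.sin ((u - v) / 2) ^ 2 +
        ellipticK k * (p * Real.cos ((u - v) / 2) * (Real.cos (u / 2) * Real.cos (v / 2) +
          k ^ 2 * (Real.sin (u / 2) * Real.sin (v / 2))) + delta k u * delta k v)) /
        (Real.pi * delta k v * Real.sin ((u - v) / 2) ^ 2)) v := by
  have hb : HasDerivAt (fun v => bracket p k u v) _ v :=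
    ((((hasDerivAt_delta hk v).mul (hasDerivAt_cot_sub h)).sub
      (hasDerivAt_sin_mul_cos_div hk v)).const_mul p).add
      (((hasDerivAt_cot_sub h).const_mul (delta k u)).add_const
        ((1 - k ^ 2) * (Real.sin (u / 2) * Real.cos (u / 2)) / (delta k u + k)))
  have hT : HasDerivAt (fun v => Ttilde (p, k, u, v)) _ v :=
    ((((((hasDerivAt_Ftilde hk v).const_mul (ellipticE k)).sub
      ((hasDerivAt_Etilde hk v).const_mul (ellipticK k))).const_mul (4 * p)).sub_const
      (4 * (ellipticE k * Ftilde u k - ellipticK k * Etilde u k))).sub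
      (hb.const_mul (4 * ellipticK k))).div_const (2 * Real.pi)
  refine hT.congr_deriv ?_
  have hd := delta_pos hk v
  have hd2 := delta_sq k v
  have h1 := Real.sin_sq_add_cos_sq (v / 2)
  have h2 := Real.sin_sq_add_cos_sq ((u - v) / 2)
  -- The addition formulas leave only the sines and cosines of `v/2` and `(u - v)/2`, so the claim
  -- becomes polynomial modulo `δ² = cos² + k² sin²` at `v` and the Pythagorean identity for these
  -- two angles. The value `delta k u` needs no expansion.
  have hu : u / 2 = v / 2 + (u - v) / 2 := by ring
  rw [Real.cot_eq_cos_div_sin, hu, Real.sin_add, Real.cos_add]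
  generalize Real.sin ((u - v) / 2) = S at *
  generalize Real.cos ((u - v) / 2) = X at *
  generalize Real.sin (v / 2) = a at *
  generalize Real.cos (v / 2) = c at *
  generalize delta k v = d at *
  have hpi := Real.pi_pos
  have : d + k ≠ 0 := by positivity
  field_simp
  linear_combination 4 * (d + k) * p * ellipticK k *
    (-hd2 + (c ^ 2 + k ^ 2 * a ^ 2) * h2 - S ^ 2 * h1)

/-- Cauchy–Schwarz for the vectors `(cos, k sin)` at `u/2` and `v/2`, proved by Lagrange's identity:
the difference of the squares is the square of their determinant, which is the hint below. -/
theorem abs_inner_le_delta_mul_delta (k u v : ℝ) :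
    |Real.cos (u / 2) * Real.cos (v / 2) + k ^ 2 * (Real.sin (u / 2) * Real.sin (v / 2))| ≤
      delta k u * delta k v := by
  refine abs_le_of_sq_le_sq ?_ (mul_nonneg (Real.sqrt_nonneg _) (Real.sqrt_nonneg _))
  rw [mul_pow, delta_sq, delta_sq]
  nlinarith [sq_nonneg (k * (Real.cos (u / 2) * Real.sin (v / 2) -
    Real.sin (u / 2) * Real.cos (v / 2)))]

theorem deriv_Ttilde_neg {p k u v : ℝ} (hp0 : 0 < p) (hp1 : p ≤ 1) (hk : k ∈ Ioo (0 : ℝ) 1)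
    (h : Real.sin ((u - v) / 2) ≠ 0) : deriv (fun v => Ttilde (p, k, u, v)) v < 0 := by
  rw [(hasDerivAt_Ttilde hk.1 h).deriv]
  have hC := abs_inner_le_delta_mul_delta k u v
  have hK := ellipticK_pos hk
  have hE := ellipticE_le_ellipticK hk
  have hD : 0 < delta k u * delta k v := mul_pos (delta_pos hk.1 u) (delta_pos hk.1 v)
  have hS : 0 < Real.sin ((u - v) / 2) ^ 2 := by positivity
  have hX : |Real.cos ((u - v) / 2)| < 1 := by
    rw [← sq_lt_one_iff_abs_lt_one]
    linarith [Real.sin_sq_add_cos_sq ((u - v) / 2)]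
  generalize Real.cos (u / 2) * Real.cos (v / 2) +
    k ^ 2 * (Real.sin (u / 2) * Real.sin (v / 2)) = C at *
  -- The only use of `p ≤ 1`. Strictness comes from the cosine, since the sine at the same angle is
  -- nonzero.
  have hpX : |p * Real.cos ((u - v) / 2)| < 1 := by
    rw [abs_mul, abs_of_pos hp0]
    nlinarith [abs_nonneg (Real.cos ((u - v) / 2))]
  have key : |p * Real.cos ((u - v) / 2) * C| < delta k u * delta k v := by
    rw [abs_mul]
    nlinarith [abs_nonneg C, abs_nonneg (p * Real.cos ((u - v) / 2))]
  have h3 : 0 < p * Real.cos ((u - v) / 2) * C + delta k u * delta k v := by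
    linarith [(abs_lt.1 key).1]
  have h4 := mul_pos hK h3
  have h5 : 0 ≤ p * (ellipticK k - ellipticE k) * Real.sin ((u - v) / 2) ^ 2 :=
    mul_nonneg (mul_nonneg hp0.le (by linarith)) hS.le
  have h6 := delta_pos hk.1 v
  have hpi := Real.pi_pos
  exact div_neg_of_neg_of_pos (by linarith) (by positivity)

/-! ### Behaviour of `T̃` at the ends of the range of `ṽ`. -/

/-- `T̃` is the sum of a term that is continuous at both ends of the range of `ṽ`, and of a term
that is infinite there. -/
theorem Ttilde_eq_add_mul_inv_sin {p k : ℝ} (hk : 0 < k) (u : ℝ) : ∃ A : ℝ → ℝ, Continuous A ∧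
    ∀ v, Ttilde (p, k, u, v) = A v + -(2 * ellipticK k / Real.pi *
      (p * delta k v + delta k u) * Real.cos ((u - v) / 2)) * (Real.sin ((u - v) / 2))⁻¹ := by
  -- The witness is `T̃` with both cotangent terms deleted. The identity holds even where the sine
  -- vanishes: there the cotangent and the inverse of the sine are both `0` by convention.
  refine ⟨fun v => (4 * p * (ellipticE k * Ftilde v k - ellipticK k * Etilde v k)
      - 4 * (ellipticE k * Ftilde u k - ellipticK k * Etilde u k)
      - 4 * ellipticK k * (p * (-((1 - k ^ 2) * (Real.sin (v / 2) * Real.cos (v / 2)) /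
        (delta k v + k))) + (1 - k ^ 2) * (Real.sin (u / 2) * Real.cos (u / 2)) /
        (delta k u + k))) / (2 * Real.pi), ?_, fun v => ?_⟩
  · have h1 : Continuous fun v => Ftilde v k :=
      continuous_iff_continuousAt.2 fun v => (hasDerivAt_Ftilde hk v).continuousAt
    have h2 : Continuous fun v => Etilde v k :=
      continuous_iff_continuousAt.2 fun v => (hasDerivAt_Etilde hk v).continuousAt
    have h3 : Continuous fun v => (1 - k ^ 2) * (Real.sin (v / 2) * Real.cos (v / 2)) /
        (delta k v + k) :=
      continuous_iff_continuousAt.2 fun v => (hasDerivAt_sin_mul_cos_div hk v).continuousAt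
    fun_prop
  · have hpi := Real.pi_pos
    simp only [Ttilde, bracket, Real.cot_eq_cos_div_sin]
    ring

theorem mem_cover_iff {p k u v : ℝ} (hp : 0 < p) (hk : k ∈ Ioo (0 : ℝ) 1) :
    (p, k, u, v) ∈ cover ↔ v ∈ Ioo u (u + 2 * Real.pi) :=
  ⟨fun h => h.2.2, fun h => ⟨hp, hk, h⟩⟩

theorem sin_neg_of_mem_Ioo {u v : ℝ} (hv : v ∈ Ioo u (u + 2 * Real.pi)) :
    Real.sin ((u - v) / 2) < 0 :=
  Real.sin_neg_of_neg_of_neg_pi_lt (by linarith [hv.1]) (by linarith [hv.2])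

/-- The sine tends to `0` from below, and its inverse is multiplied by a coefficient with a negative
limit, the cosine being `1` at this end. -/
theorem tendsto_Ttilde_nhdsGT {p k u : ℝ} (hp : 0 < p) (hk : k ∈ Ioo (0 : ℝ) 1) :
    Tendsto (fun v => Ttilde (p, k, u, v)) (𝓝[>] u) atTop := by
  obtain ⟨A, hA, hT⟩ := Ttilde_eq_add_mul_inv_sin (p := p) hk.1 u
  have hd := continuous_delta k
  have hpi := Real.two_pi_pos
  have hs : Tendsto (fun v => (Real.sin ((u - v) / 2))⁻¹) (𝓝[>] u) atBot := by
    refine tendsto_inv_nhdsLT_zero.comp (tendsto_nhdsWithin_iff.2 ⟨?_, ?_⟩)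
    · have : Tendsto (fun v => Real.sin ((u - v) / 2)) (𝓝 u) (𝓝 (Real.sin ((u - u) / 2))) :=
        Continuous.tendsto (by fun_prop) u
      rw [sub_self, zero_div, Real.sin_zero] at this
      exact this.mono_left nhdsWithin_le_nhds
    · filter_upwards [Ioo_mem_nhdsGT (show u < u + 2 * Real.pi by linarith)] with v hv
      exact sin_neg_of_mem_Ioo hv
  have hB : Tendsto (fun v => -(2 * ellipticK k / Real.pi * (p * delta k v + delta k u) *
      Real.cos ((u - v) / 2))) (𝓝[>] u) (𝓝 (-(2 * ellipticK k / Real.pi *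
      (p * delta k u + delta k u) * Real.cos ((u - u) / 2)))) :=
    (Continuous.tendsto (by fun_prop) u).mono_left nhdsWithin_le_nhds
  have hneg : -(2 * ellipticK k / Real.pi *
      (p * delta k u + delta k u) * Real.cos ((u - u) / 2)) < 0 := by
    have := ellipticK_pos hk
    have := delta_pos hk.1 u
    rw [sub_self, zero_div, Real.cos_zero, neg_lt_zero]
    have := Real.pi_pos
    positivity
  simp_rw [hT]
  exact ((hA.tendsto u).mono_left nhdsWithin_le_nhds).add_atTop (hB.neg_mul_atBot hneg hs)

/-- The sine again tends to `0` from below, but now the cosine tends to `-1`, which reverses the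
sign of the coefficient and of the infinity. -/
theorem tendsto_Ttilde_nhdsLT {p k u : ℝ} (hp : 0 < p) (hk : k ∈ Ioo (0 : ℝ) 1) :
    Tendsto (fun v => Ttilde (p, k, u, v)) (𝓝[<] (u + 2 * Real.pi)) atBot := by
  obtain ⟨A, hA, hT⟩ := Ttilde_eq_add_mul_inv_sin (p := p) hk.1 u
  have hd := continuous_delta k
  have hpi := Real.two_pi_pos
  have hu : (u - (u + 2 * Real.pi)) / 2 = -Real.pi := by ring
  have hs : Tendsto (fun v => (Real.sin ((u - v) / 2))⁻¹) (𝓝[<] (u + 2 * Real.pi)) atBot := by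
    refine tendsto_inv_nhdsLT_zero.comp (tendsto_nhdsWithin_iff.2 ⟨?_, ?_⟩)
    · have : Tendsto (fun v => Real.sin ((u - v) / 2)) (𝓝 (u + 2 * Real.pi))
          (𝓝 (Real.sin ((u - (u + 2 * Real.pi)) / 2))) :=
        Continuous.tendsto (by fun_prop) _
      rw [hu, Real.sin_neg, Real.sin_pi, neg_zero] at this
      exact this.mono_left nhdsWithin_le_nhds
    · filter_upwards [Ioo_mem_nhdsLT (show u < u + 2 * Real.pi by linarith)] with v hv
      exact sin_neg_of_mem_Ioo hv
  have hB : Tendsto (fun v => -(2 * ellipticK k / Real.pi * (p * delta k v + delta k u) *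
      Real.cos ((u - v) / 2))) (𝓝[<] (u + 2 * Real.pi)) (𝓝 (-(2 * ellipticK k / Real.pi *
      (p * delta k (u + 2 * Real.pi) + delta k u) *
      Real.cos ((u - (u + 2 * Real.pi)) / 2)))) :=
    (Continuous.tendsto (by fun_prop) _).mono_left nhdsWithin_le_nhds
  have hpos : 0 < -(2 * ellipticK k / Real.pi *
      (p * delta k (u + 2 * Real.pi) + delta k u) *
      Real.cos ((u - (u + 2 * Real.pi)) / 2)) := by
    have := ellipticK_pos hk
    have := delta_pos hk.1 u
    have := delta_pos hk.1 (u + 2 * Real.pi)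
    rw [hu, Real.cos_neg, Real.cos_pi, mul_neg_one, neg_neg]
    have := Real.pi_pos
    positivity
  simp_rw [hT]
  exact ((hA.tendsto _).mono_left nhdsWithin_le_nhds).add_atBot (hB.pos_mul_atBot hpos hs)

/-! ### Solving `T̃ = q` for `ṽ` when `p ≤ 1`. -/

theorem continuousOn_Ttilde_Ioo {p k u : ℝ} (hk : k ∈ Ioo (0 : ℝ) 1) :
    ContinuousOn (fun v => Ttilde (p, k, u, v)) (Ioo u (u + 2 * Real.pi)) := fun _ hv =>
  (hasDerivAt_Ttilde hk.1 (sin_neg_of_mem_Ioo hv).ne).continuousAt.continuousWithinAt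

/-- For `p ≤ 1` and fixed `k`, `ũ`, the function `T̃` of `ṽ` takes every value exactly once. -/
theorem existsUnique_Ttilde_eq {p k : ℝ} (hp : 0 < p) (hp1 : p ≤ 1) (hk : k ∈ Ioo (0 : ℝ) 1)
    (u q : ℝ) : ∃! v, v ∈ Ioo u (u + 2 * Real.pi) ∧ Ttilde (p, k, u, v) = q := by
  have hlt : u < u + 2 * Real.pi := by linarith [Real.two_pi_pos]
  have hanti : StrictAntiOn (fun v => Ttilde (p, k, u, v)) (Ioo u (u + 2 * Real.pi)) := by
    refine strictAntiOn_of_deriv_neg (convex_Ioo _ _) (continuousOn_Ttilde_Ioo hk) fun v hv => ?_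
    rw [interior_Ioo] at hv
    exact deriv_Ttilde_neg hp hp1 hk (sin_neg_of_mem_Ioo hv).ne
  have hsurj := (continuousOn_Ttilde_Ioo (p := p) (u := u) hk).surjOn_of_tendsto'
    (nonempty_Ioo.2 hlt) ((tendsto_comp_coe_Ioo_atBot hlt).2 (tendsto_Ttilde_nhdsGT hp hk))
    ((tendsto_comp_coe_Ioo_atTop hlt).2 (tendsto_Ttilde_nhdsLT hp hk))
  obtain ⟨v, hv, hvq⟩ := hsurj (mem_univ q)
  exact ⟨v, ⟨hv, hvq⟩, fun w hw => hanti.injOn hw.1 hv (hw.2.trans hvq.symm)⟩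

/-- For `p ≤ 1` the equation `T̃ = q` has a smooth solution for `ṽ`. -/
theorem exists_contDiffOn_solution {p : ℝ} (hp : 0 < p) (hp1 : p ≤ 1) :
    ∃ g : ℝ × ℝ × ℝ → ℝ, ContDiffOn ℝ ∞ g (univ ×ˢ Ioo 0 1 ×ˢ univ) ∧
      ∀ q, ∀ k ∈ Ioo (0 : ℝ) 1, ∀ u v,
        ((p, k, u, v) ∈ cover ∧ Ttilde (p, k, u, v) = q) ↔ v = g (q, k, u) := by
  -- The value `q` is kept as a variable beside `k` and `ũ`, since the inverse diffeomorphism must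
  -- be smooth in all three.
  choose! g hg huniq using fun (x : ℝ × ℝ × ℝ) (hx : x.2.1 ∈ Ioo (0 : ℝ) 1) =>
    existsUnique_Ttilde_eq hp hp1 hx x.2.2 x.1
  -- `φ` sends `((q, k, ũ), ṽ)` to `(p, k, ũ, ṽ)`; the equation to be solved is `T̃ ∘ φ - q = 0` on
  -- the open set `φ ⁻¹' cover`.
  let φ : (ℝ × ℝ × ℝ) × ℝ → ℝ × ℝ × ℝ × ℝ := fun z => (p, z.1.2.1, z.1.2.2, z.2)
  have hφ : ContDiff ℝ ∞ φ := by unfold φ; fun_prop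
  have hf : ContDiffOn ℝ ∞ (fun z => Ttilde (φ z) - z.1.1) (φ ⁻¹' cover) :=
    (contDiffOn_Ttilde.comp hφ.contDiffOn fun z hz => hz).sub (by fun_prop)
  have hd : ∀ z ∈ φ ⁻¹' cover, deriv (fun v => Ttilde (φ (z.1, v)) - z.1.1) z.2 ≠ 0 := by
    rintro ⟨⟨q, k, u⟩, v⟩ ⟨-, hk, hv⟩
    rw [deriv_sub_const]
    exact (deriv_Ttilde_neg hp hp1 hk (sin_neg_of_mem_Ioo hv).ne).ne
  refine ⟨g, contDiffOn_of_unique_solution (isOpen_cover.preimage hφ.continuous) hf hd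
    (isOpen_univ.prod (isOpen_Ioo.prod isOpen_univ)) ?_ ?_, fun q k hk u v => ⟨?_, ?_⟩⟩
  · rintro x ⟨-, hx, -⟩
    exact ⟨(mem_cover_iff hp hx).2 (hg x hx).1, sub_eq_zero.2 (hg x hx).2⟩
  · rintro x ⟨-, hx, -⟩ v ⟨-, -, hv⟩ h0
    exact huniq x hx v ⟨hv, sub_eq_zero.1 h0⟩
  · rintro ⟨⟨-, -, hv⟩, hT⟩
    exact huniq (q, k, u) hk v ⟨hv, hT⟩
  · rintro rfl
    exact ⟨(mem_cover_iff hp hk).2 (hg (q, k, u) hk).1, (hg (q, k, u) hk).2⟩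

/-! ### The symmetry exchanging `ũ` and `ṽ`, and the case `p ≥ 1`. -/

theorem delta_neg (k s : ℝ) : delta k (-s) = delta k s := by
  simp [delta, neg_div]

theorem Ftilde_neg (s k : ℝ) : Ftilde (-s) k = -Ftilde s k := by
  have := intervalIntegral.integral_comp_neg (a := 0) (b := s) fun t => 1 / delta k t
  simp only [delta_neg, neg_zero] at this
  rw [Ftilde, Ftilde, this, intervalIntegral.integral_symm]
  ring

theorem Etilde_neg (s k : ℝ) : Etilde (-s) k = -Etilde s k := by
  have := intervalIntegral.integral_comp_neg (a := 0) (b := s) fun t => 1 / (delta k t + k)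
  simp only [delta_neg, neg_zero] at this
  rw [Etilde, Etilde, this, intervalIntegral.integral_symm]
  ring

/-- The symmetry of `T̃` that exchanges `ũ` and `ṽ`. -/
theorem Ttilde_symm {p : ℝ} (hp : p ≠ 0) (k u v : ℝ) :
    Ttilde (p, k, u, v) = p * Ttilde (p⁻¹, k, -v, -u) := by
  have h : (-v - -u) / 2 = (u - v) / 2 := by ring
  simp only [Ttilde, bracket, Ftilde_neg, Etilde_neg, delta_neg, neg_div, Real.sin_neg,
    Real.cos_neg, h]
  field_simp
  ring

/-- Replacing `(u, v)` by `(-v, -u)` preserves the gap `v - u`, which is all that the last two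
conditions constrain. -/
theorem mem_cover_symm {p : ℝ} (k u v : ℝ) :
    (p, k, u, v) ∈ cover ↔ (p⁻¹, k, -v, -u) ∈ cover := by
  simp only [cover, mem_ofPred_eq, inv_pos]
  refine and_congr_right fun _ => and_congr_right fun _ => ?_
  constructor <;> rintro ⟨h1, h2⟩ <;> constructor <;> linarith

/-- For `1 ≤ p` the equation `T̃ = q` has a smooth solution for `ũ`. -/
theorem exists_contDiffOn_solution' {p : ℝ} (hp : 0 < p) (hp1 : 1 ≤ p) :
    ∃ g : ℝ × ℝ × ℝ → ℝ, ContDiffOn ℝ ∞ g (univ ×ˢ Ioo 0 1 ×ˢ univ) ∧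
      ∀ q, ∀ k ∈ Ioo (0 : ℝ) 1, ∀ u v,
        ((p, k, u, v) ∈ cover ∧ Ttilde (p, k, u, v) = q) ↔ u = g (q, k, v) := by
  obtain ⟨g, hg, hsol⟩ := exists_contDiffOn_solution (inv_pos.2 hp) (inv_le_one_of_one_le₀ hp1)
  -- By the symmetry `T̃ = q` at `(p, k, u, v)` means `T̃ = p⁻¹ q` at `(p⁻¹, k, -v, -u)`, which is
  -- solved for its last coordinate `-u`.
  refine ⟨fun x => -g (p⁻¹ * x.1, x.2.1, -x.2.2), ?_, fun q k hk u v => ?_⟩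
  · exact (hg.comp (f := fun x : ℝ × ℝ × ℝ => (p⁻¹ * x.1, x.2.1, -x.2.2)) (by fun_prop)
      fun x hx => ⟨mem_univ _, hx.2.1, mem_univ _⟩).neg
  · rw [mem_cover_symm, Ttilde_symm hp.ne', ← neg_eq_iff_eq_neg, ← hsol _ k hk,
      eq_inv_mul_iff_mul_eq₀ hp.ne']

/-! ### From the solution function to the diffeomorphisms and graphs. -/

/-- The only point of the proof at which the projection `π̃` enters; from here on the level set of
`S` is a coordinate slice. -/
theorem mem_coverS_iff {p : ℝ} {x : ℝ × ℝ × ℝ × ℝ} : x ∈ coverS p ↔ x ∈ cover ∧ x.1 = p :=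
  and_congr_right fun hx => by rw [S_proj hx]

theorem _root_.ContDiffOn.smoothOn {E F : Type*} [NormedAddCommGroup E] [NormedSpace ℝ E]
    [NormedAddCommGroup F] [NormedSpace ℝ F] {f : E → F} {X U : Set E} (hf : ContDiffOn ℝ ∞ f U)
    (hU : IsOpen U) (hXU : X ⊆ U) : SmoothOn f X :=
  fun _ hx => ⟨U, f, hU, hXU hx, hf, fun _ _ => rfl⟩

end GenusOne

theorem mainTheorem5 (p : ℝ) (hp : 0 < p) :
    (p ≤ 1 →
      GenusOne.IsDiffeoOn
        (fun x : ℝ × ℝ × ℝ × ℝ => (GenusOne.Ttilde x, x.2.1, x.2.2.1))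
        (GenusOne.coverS p)
        ((Set.univ : Set ℝ) ×ˢ (Set.Ioo (0 : ℝ) 1) ×ˢ (Set.univ : Set ℝ)) ∧
      ∀ q : ℝ, ∃ h : ℝ × ℝ → ℝ,
        ContDiffOn ℝ ∞ h ((Set.Ioo (0 : ℝ) 1) ×ˢ (Set.univ : Set ℝ)) ∧
        GenusOne.coverST p q =
          {x | ∃ k ∈ Set.Ioo (0 : ℝ) 1, ∃ u : ℝ, x = (p, k, u, h (k, u))}) ∧
    (1 ≤ p →
      GenusOne.IsDiffeoOn
        (fun x : ℝ × ℝ × ℝ × ℝ => (GenusOne.Ttilde x, x.2.1, x.2.2.2))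
        (GenusOne.coverS p)
        ((Set.univ : Set ℝ) ×ˢ (Set.Ioo (0 : ℝ) 1) ×ˢ (Set.univ : Set ℝ)) ∧
      ∀ q : ℝ, ∃ h : ℝ × ℝ → ℝ,
        ContDiffOn ℝ ∞ h ((Set.Ioo (0 : ℝ) 1) ×ˢ (Set.univ : Set ℝ)) ∧
        GenusOne.coverST p q =
          {x | ∃ k ∈ Set.Ioo (0 : ℝ) 1, ∃ v : ℝ, x = (p, k, h (k, v), v)}) := by
  have hY : IsOpen ((Set.univ : Set ℝ) ×ˢ (Set.Ioo (0 : ℝ) 1) ×ˢ (Set.univ : Set ℝ)) :=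
    isOpen_univ.prod (isOpen_Ioo.prod isOpen_univ)
  refine ⟨fun hp1 => ?_, fun hp1 => ?_⟩
  · obtain ⟨g, hg, hsol⟩ := GenusOne.exists_contDiffOn_solution hp hp1
    refine ⟨?_, fun q => ⟨fun z => g (q, z.1, z.2), hg.comp
      (f := fun z : ℝ × ℝ => (q, z.1, z.2)) (by fun_prop)
      fun z hz => ⟨Set.mem_univ _, hz.1, Set.mem_univ _⟩, ?_⟩⟩
    -- The inverse inserts the solution as `ṽ`. That it is a left inverse is uniqueness of the
    -- solution; that it is a right inverse is existence.
    · have hinv : Set.InvOn (fun y : ℝ × ℝ × ℝ => (p, y.2.1, y.2.2, g y))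
          (fun x : ℝ × ℝ × ℝ × ℝ => (GenusOne.Ttilde x, x.2.1, x.2.2.1)) (GenusOne.coverS p)
          (Set.univ ×ˢ Set.Ioo 0 1 ×ˢ Set.univ) := by
        refine ⟨?_, ?_⟩
        · rintro ⟨r, k, u, v⟩ hx
          obtain ⟨hm, rfl⟩ := GenusOne.mem_coverS_iff.1 hx
          simp [← (hsol _ k hm.2.1 u v).1 ⟨hm, rfl⟩]
        · rintro ⟨q, k, u⟩ ⟨-, hk, -⟩
          simp [((hsol q k hk u _).2 rfl).2]
      refine ⟨hinv.bijOn ?_ ?_, ?_, _, hinv, ?_⟩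
      · exact fun x hx => ⟨Set.mem_univ _, hx.1.2.1, Set.mem_univ _⟩
      · rintro ⟨q, k, u⟩ ⟨-, hk, -⟩
        exact GenusOne.mem_coverS_iff.2 ⟨((hsol q k hk u _).2 rfl).1, rfl⟩
      -- The slice itself is not open in `ℝ⁴`, but the map is smooth on the open set `cover` that
      -- contains it.
      · exact (GenusOne.contDiffOn_Ttilde.prodMk (by fun_prop)).smoothOn
          GenusOne.isOpen_cover fun x hx => hx.1
      · exact ContDiffOn.smoothOn (by fun_prop) hY subset_rfl
    · ext ⟨r, k, u, v⟩
      refine ⟨fun hx => ?_, ?_⟩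
      · obtain ⟨hc, rfl⟩ := GenusOne.mem_coverS_iff.1 hx.1
        exact ⟨k, hc.2.1, u, by simp [← (hsol q k hc.2.1 u v).1 ⟨hc, hx.2⟩]⟩
      · rintro ⟨k, hk, u, h⟩
        obtain ⟨hc, hT⟩ := (hsol q k hk u _).2 rfl
        rw [h]
        exact ⟨GenusOne.mem_coverS_iff.2 ⟨hc, rfl⟩, hT⟩
  · obtain ⟨g, hg, hsol⟩ := GenusOne.exists_contDiffOn_solution' hp hp1
    refine ⟨?_, fun q => ⟨fun z => g (q, z.1, z.2), hg.comp
      (f := fun z : ℝ × ℝ => (q, z.1, z.2)) (by fun_prop)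
      fun z hz => ⟨Set.mem_univ _, hz.1, Set.mem_univ _⟩, ?_⟩⟩
    -- As in the case `p ≤ 1`, except that the solution is now inserted as `ũ` and `ṽ` is the free
    -- coordinate.
    · have hinv : Set.InvOn (fun y : ℝ × ℝ × ℝ => (p, y.2.1, g y, y.2.2))
          (fun x : ℝ × ℝ × ℝ × ℝ => (GenusOne.Ttilde x, x.2.1, x.2.2.2)) (GenusOne.coverS p)
          (Set.univ ×ˢ Set.Ioo 0 1 ×ˢ Set.univ) := by
        refine ⟨?_, ?_⟩
        · rintro ⟨r, k, u, v⟩ hx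
          obtain ⟨hm, rfl⟩ := GenusOne.mem_coverS_iff.1 hx
          simp [← (hsol _ k hm.2.1 u v).1 ⟨hm, rfl⟩]
        · rintro ⟨q, k, v⟩ ⟨-, hk, -⟩
          simp [((hsol q k hk _ v).2 rfl).2]
      refine ⟨hinv.bijOn ?_ ?_, ?_, _, hinv, ?_⟩
      · exact fun x hx => ⟨Set.mem_univ _, hx.1.2.1, Set.mem_univ _⟩
      · rintro ⟨q, k, v⟩ ⟨-, hk, -⟩
        exact GenusOne.mem_coverS_iff.2 ⟨((hsol q k hk _ v).2 rfl).1, rfl⟩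
      · exact (GenusOne.contDiffOn_Ttilde.prodMk (by fun_prop)).smoothOn
          GenusOne.isOpen_cover fun x hx => hx.1
      · exact ContDiffOn.smoothOn (by fun_prop) hY subset_rfl
    · ext ⟨r, k, u, v⟩
      refine ⟨fun hx => ?_, ?_⟩
      · obtain ⟨hc, rfl⟩ := GenusOne.mem_coverS_iff.1 hx.1
        exact ⟨k, hc.2.1, v, by simp [← (hsol q k hc.2.1 u v).1 ⟨hc, hx.2⟩]⟩
      · rintro ⟨k, hk, v, h⟩
        obtain ⟨hc, hT⟩ := (hsol q k hk _ v).2 rfl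
        rw [h]
        exact ⟨GenusOne.mem_coverS_iff.2 ⟨hc, rfl⟩, hT⟩
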